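/- **Theorem 1.1.** Let $K$ be an algebraically closed field of characteristic $0$. A *birational morphism* of the affine plane $A^2$ over $K$ is a $K$-algebra endomorphism $\varphi$ of $K[x,y]$ such that $K(\varphi(x),\varphi(y))=K(x,y)$. A *simple affine contraction* is a $K$-algebra automorphism of $K[x,y]$ or the endomorphism $x\mapsto x,\ y\mapsto xy$. Then there is an algorithm that decides whether a given birational morphism of $A^2$ over $K$ is a product (composition) of finitely many simple affine contractions. Here it is assumed that calculations in $K$ can be performed, in the following sense. A birational morphism $\varphi$ is given by finite lists of the terms of $\varphi(x)$ and $\varphi(y)$, where the exponents are natural numbers and the coefficients are elements of $K$ held in registers. The algorithm is a Turing computable rule that determines, from the lists of exponents and register numbers and from the results of all previous tests, the next action: either to test whether two arithmetic expressions (built from $0$, $1$ and the registers by $+,-,\cdot,/$, where $a/0=0$) have equal values in $K$, or to stop with the answer "yes" or "no". For every birational morphism $\varphi$ of $A^2$ over $K$, however it is given in this way, the algorithm stops after finitely many steps; it answers "yes" if $\varphi$ is a product of simple affine contractions and "no" otherwise. -/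

import Mathlib

/-! ### Birational morphisms of the affine plane -/

/-- `K[x, y]`, with `x = X 0` and `y = X 1`. -/
abbrev PlaneRing (K : Type*) [Field K] : Type _ := MvPolynomial (Fin 2) K

/-- Polynomial mappings `A² → A²`, written as endomorphisms of the `K`-algebra `K[x, y]`.
They form a monoid under composition. -/
abbrev PlaneEnd (K : Type*) [Field K] : Type _ := PlaneRing K →ₐ[K] PlaneRing K

/-- `φ` is a birational morphism: `K(φ(x), φ(y)) = K(x, y)`. -/
def IsBirationalMorphism {K : Type*} [Field K] (φ : PlaneEnd K) : Prop :=
  IntermediateField.adjoin K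
    ({algebraMap (PlaneRing K) (FractionRing (PlaneRing K)) (φ (MvPolynomial.X 0)),
      algebraMap (PlaneRing K) (FractionRing (PlaneRing K)) (φ (MvPolynomial.X 1))} :
      Set (FractionRing (PlaneRing K))) = ⊤

/-- The contraction `x ↦ x`, `y ↦ x * y`. -/
noncomputable def contractionX (K : Type*) [Field K] : PlaneEnd K :=
  MvPolynomial.aeval ![MvPolynomial.X 0, MvPolynomial.X 0 * MvPolynomial.X 1]

/-- A simple affine contraction is a polynomial automorphism or the mapping `x ↦ x`, `y ↦ x * y`. -/
def IsSimpleAffineContraction {K : Type*} [Field K] (φ : PlaneEnd K) : Prop :=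
  Function.Bijective φ ∨ φ = contractionX K

/-- `φ` is a composition of finitely many simple affine contractions. -/
def IsProductOfSimpleAffineContractions {K : Type*} [Field K] (φ : PlaneEnd K) : Prop :=
  φ ∈ Submonoid.closure {ψ : PlaneEnd K | IsSimpleAffineContraction ψ}

/-! ### Arithmetic expressions -/

/-- Arithmetic expressions in the elements stored in the registers `0, 1, 2, …`. -/
inductive ArithExpr : Type
  | zero : ArithExpr
  | one : ArithExpr
  | reg (i : ℕ) : ArithExpr
  | add (a b : ArithExpr) : ArithExpr
  | sub (a b : ArithExpr) : ArithExpr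
  | mul (a b : ArithExpr) : ArithExpr
  | div (a b : ArithExpr) : ArithExpr

namespace ArithExpr

/-- The value of an expression when register `i` holds the element `c i`.
A quotient whose denominator is `0` has the value `0`. -/
def eval {K : Type*} [Field K] (c : ℕ → K) : ArithExpr → K
  | zero => 0
  | one => 1
  | reg i => c i
  | add a b => eval c a + eval c b
  | sub a b => eval c a - eval c b
  | mul a b => eval c a * eval c b
  | div a b => eval c a / eval c b

/-- The standard numbering of expressions by natural numbers. -/
def toNat : ArithExpr → ℕ
  | zero => 0
  | one => 1
  | reg i => 5 * i + 2
  | add a b => 5 * Nat.pair (toNat a) (toNat b) + 3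
  | sub a b => 5 * Nat.pair (toNat a) (toNat b) + 4
  | mul a b => 5 * Nat.pair (toNat a) (toNat b) + 5
  | div a b => 5 * Nat.pair (toNat a) (toNat b) + 6

/-- The expression with a given number. -/
def ofNat : ℕ → ArithExpr
  | 0 => zero
  | 1 => one
  | n + 2 =>
    have h1 : (Nat.unpair (n / 5)).1 < n + 2 :=
      lt_of_le_of_lt (Nat.unpair_left_le _) (by omega)
    have h2 : (Nat.unpair (n / 5)).2 < n + 2 :=
      lt_of_le_of_lt (Nat.unpair_right_le _) (by omega)
    if n % 5 = 0 then reg (n / 5)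
    else if n % 5 = 1 then
      add (ofNat (Nat.unpair (n / 5)).1) (ofNat (Nat.unpair (n / 5)).2)
    else if n % 5 = 2 then
      sub (ofNat (Nat.unpair (n / 5)).1) (ofNat (Nat.unpair (n / 5)).2)
    else if n % 5 = 3 then
      mul (ofNat (Nat.unpair (n / 5)).1) (ofNat (Nat.unpair (n / 5)).2)
    else
      div (ofNat (Nat.unpair (n / 5)).1) (ofNat (Nat.unpair (n / 5)).2)

theorem ofNat_toNat (e : ArithExpr) : ofNat (toNat e) = e := by
  induction e with
  | zero => simp [toNat, ofNat]
  | one => simp [toNat, ofNat]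
  | reg i => simp [toNat, ofNat]
  | add a b iha ihb =>
    have h : ∀ m : ℕ, (5 * m + 1) % 5 = 1 ∧ (5 * m + 1) / 5 = m := by omega
    simp [toNat, ofNat, h, iha, ihb]
  | sub a b iha ihb =>
    have h : ∀ m : ℕ, (5 * m + 2) % 5 = 2 ∧ (5 * m + 2) / 5 = m := by omega
    simp [toNat, ofNat, h, iha, ihb]
  | mul a b iha ihb =>
    have h : ∀ m : ℕ, (5 * m + 3) % 5 = 3 ∧ (5 * m + 3) / 5 = m := by omega
    simp [toNat, ofNat, h, iha, ihb]
  | div a b iha ihb =>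
    have h : ∀ m : ℕ, (5 * m + 4) % 5 = 4 ∧ (5 * m + 4) / 5 = m := by omega
    simp [toNat, ofNat, h, iha, ihb]

theorem toNat_ofNat (n : ℕ) : toNat (ofNat n) = n := by
  induction n using Nat.strong_induction_on with
  | _ n ih =>
    match n with
    | 0 => simp [toNat, ofNat]
    | 1 => simp [toNat, ofNat]
    | n + 2 =>
      have h1 := ih (Nat.unpair (n / 5)).1
        (lt_of_le_of_lt (Nat.unpair_left_le _) (by omega))
      have h2 := ih (Nat.unpair (n / 5)).2
        (lt_of_le_of_lt (Nat.unpair_right_le _) (by omega))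
      rw [ofNat]
      split_ifs <;> simp only [toNat, h1, h2, Nat.pair_unpair] <;> omega

/-- The numbering is a bijection with `ℕ`; Turing computability on expressions refers to it. -/
instance instDenumerable : Denumerable ArithExpr :=
  Denumerable.mk'
    { toFun := toNat, invFun := ofNat, left_inv := ofNat_toNat, right_inv := toNat_ofNat }

end ArithExpr

/-! ### Input of the decision problem -/

/-- A polynomial in `x, y` in sparse form: the entry `(m, n, i)` stands for the term
`c i * x ^ m * y ^ n`, where `c i` is the element of the field held in register `i`. -/
abbrev SparsePoly : Type := List (ℕ × ℕ × ℕ)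

/-- The polynomial that is written down by a sparse form and the content `c` of the registers. -/
noncomputable def SparsePoly.toPoly {K : Type*} [Field K] (c : ℕ → K) (p : SparsePoly) :
    PlaneRing K :=
  (p.map fun t => MvPolynomial.C (c t.2.2) * MvPolynomial.X 0 ^ t.1 * MvPolynomial.X 1 ^ t.2.1).sum

/-- The sparse form and the content of the registers present the mapping
`x ↦ φ(x)`, `y ↦ φ(y)`. -/
def Presents {K : Type*} [Field K] (d : SparsePoly × SparsePoly) (c : ℕ → K) (φ : PlaneEnd K) :
    Prop :=
  SparsePoly.toPoly c d.1 = φ (MvPolynomial.X 0) ∧ SparsePoly.toPoly c d.2 = φ (MvPolynomial.X 1)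

/-! ### Algorithms with exact arithmetic and equality tests in the field -/

/-- An algorithm that can perform calculations in a field. It receives finite data `d`, and the
registers hold elements of the field that it can access only through equality tests between
arithmetic expressions. From `d` and the list of the results of all its previous tests, a Turing
computable rule finds what to do next: to test whether two expressions are equal (`Sum.inl`), or
to stop with a yes/no answer (`Sum.inr`). -/
structure FieldAlgorithm (D : Type) [Primcodable D] where
  next : D × List Bool → (ArithExpr × ArithExpr) ⊕ Bool
  computable_next : Computable next

namespace FieldAlgorithm

variable {D : Type} [Primcodable D]

open scoped Classical in
/-- The results of the tests made in the first `n` steps of the run, in chronological order, on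
the data `d` when register `i` holds `c i`. After the algorithm has stopped the list does not
change any more. -/
noncomputable def history {K : Type*} [Field K] (A : FieldAlgorithm D) (d : D) (c : ℕ → K) :
    ℕ → List Bool
  | 0 => []
  | n + 1 =>
    match A.next (d, history A d c n) with
    | Sum.inl q => history A d c n ++ [decide (q.1.eval c = q.2.eval c)]
    | Sum.inr _ => history A d c n

/-- The algorithm stops after finitely many steps and gives the answer `b`. -/
def Outputs {K : Type*} [Field K] (A : FieldAlgorithm D) (d : D) (c : ℕ → K) (b : Bool) : Prop :=
  ∃ n : ℕ, A.next (d, A.history d c n) = Sum.inr b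

end FieldAlgorithm

/-!
The decision procedure reduces the existence of a factorisation to the solvability of a system of
polynomial equations over `K`, and then looks for a certificate of solvability or of unsolvability.

*Bounds.* Let `φ` be a product of automorphisms and of `n` contractions `κ : x ↦ x, y ↦ x * y`.
The Jacobian determinant of `φ` is the product of `n` nonconstant polynomials, which gives
`n ≤ 2 * deg φ`. In `φ = α * κ * ψ` the first coordinate `s` of `α` divides the Jacobian
determinant, so its degree is bounded. The second coordinate `t` may be replaced by `t + q(s)`,
because triangular automorphisms can be moved past `κ`, and for a suitable `q` its degree is bounded
in terms of `deg s` (`exists_totalDegree_add_aeval_le`): the derivation `J(s, ·)`, which is `∂/∂t`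
up to a constant, leads from `x` or `y` to some `b(s) * t + a(s)` after a number of steps that is
bounded by a dimension count (`natDegree_symm_X_zero_le`), and `q = a / b` will do. The same
dimension count bounds the degree of `α⁻¹` (`mapDegree_symm_le`), hence that of
`κ * ψ = α⁻¹ * φ` and of `ψ`, and induction bounds all factors
(`IsProductOfSimpleAffineContractions.boundedProduct`).

*The system.* Factorisations with a bounded number of factors of bounded degree are the solutions of
a finite system of polynomial equations in the coefficients of the factors and of their inverses.
In each factor a parameter `e` interpolates between the identity and the contraction, and every
value of `e` is harmless, so no case distinction is needed (`IsSolution.isProduct`,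
`BoundedProduct.exists_isSolution`). All equations are packed into one polynomial in auxiliary
variables `x, y, u`. It is written in terms of abstract operations (`Ops`), so that one definition
serves for computations in rings as well as for symbolic expressions.

*Certificates.* Let `k` be the field generated by the register contents; its elements are the values
of arithmetic expressions. By the Nullstellensatz, either the equations generate the unit ideal over
`k`, or they have a solution in a finite extension of `k`. The latter has a primitive element, so the
solution consists of polynomials in `T` that satisfy the equations modulo a monic polynomial in
`T`. Both alternatives are witnessed by polynomial identities with coefficients in `k`
(`exists_cert`), and conversely such an identity shows that there is no solution in `K`, or that
there is one, since `K` is algebraically closed. An identity is checked by a single equality test,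
because `e / e` is `0` or `1` according to whether `e` vanishes (`SymPoly.eval_zeroTest`). The
algorithm `certSearch` runs through all certificates until one passes its test; each test is
primitive recursive in the data and in the number of the certificate.
-/

/-! ### Degrees of bivariate polynomials -/

open Polynomial in
/-- The total degree is at most the sum of the degrees in the two variables. -/
theorem totalDegree_equivMvPolynomial_le {K : Type*} [Field K] (P : K[X][X]) :
    (Polynomial.Bivariate.equivMvPolynomial K P).totalDegree ≤
      P.natDegree + (Polynomial.Bivariate.swap P).natDegree := by
  have hcoeff : ∀ (P : K[X][X]) (i j : ℕ),
      ((Polynomial.Bivariate.swap P).coeff i).coeff j = (P.coeff j).coeff i := by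
    intro P i j
    induction P using Polynomial.induction_on' with
    | add p q hp hq => simp [hp, hq]
    | monomial n f =>
      induction f using Polynomial.induction_on' with
      | add p q hp hq => simp [hp, hq]
      | monomial m r =>
        rw [Polynomial.Bivariate.swap_monomial_monomial]
        simp only [Polynomial.coeff_monomial]
        split_ifs <;> simp_all [Polynomial.coeff_monomial]
  have hsum : P = ∑ j ∈ Finset.range (P.natDegree + 1),
      ∑ i ∈ Finset.range ((Polynomial.Bivariate.swap P).natDegree + 1),
        C (C ((P.coeff j).coeff i)) * C (X ^ i) * X ^ j := by
    conv_lhs => rw [P.as_sum_range_C_mul_X_pow]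
    refine Finset.sum_congr rfl fun j _ => ?_
    rw [← Finset.sum_mul]
    congr 1
    have hd : (P.coeff j).natDegree < (Polynomial.Bivariate.swap P).natDegree + 1 := by
      rw [Nat.lt_succ_iff, Polynomial.natDegree_le_iff_coeff_eq_zero]
      intro i hi
      rw [← hcoeff, Polynomial.coeff_eq_zero_of_natDegree_lt hi, Polynomial.coeff_zero]
    conv_lhs => rw [(P.coeff j).as_sum_range_C_mul_X_pow' hd]
    simp [map_sum]
  conv_lhs => rw [hsum, map_sum]
  refine MvPolynomial.totalDegree_finsetSum_le fun j hj => ?_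
  rw [map_sum]
  refine MvPolynomial.totalDegree_finsetSum_le fun i hi => ?_
  have hterm : Polynomial.Bivariate.equivMvPolynomial K
      (C (C ((P.coeff j).coeff i)) * C (X ^ i) * X ^ j) =
      MvPolynomial.C ((P.coeff j).coeff i) * MvPolynomial.X 0 ^ i * MvPolynomial.X 1 ^ j := by
    simp
  rw [hterm]
  have h1 := MvPolynomial.totalDegree_mul
    (MvPolynomial.C ((P.coeff j).coeff i) * MvPolynomial.X 0 ^ i : MvPolynomial (Fin 2) K)
    (MvPolynomial.X 1 ^ j)
  have h2 := MvPolynomial.totalDegree_mul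
    (MvPolynomial.C ((P.coeff j).coeff i) : MvPolynomial (Fin 2) K) (MvPolynomial.X 0 ^ i)
  rw [MvPolynomial.totalDegree_X_pow] at h1 h2
  rw [MvPolynomial.totalDegree_C] at h2
  rw [Finset.mem_range] at hi hj
  omega

theorem finrank_restrictTotalDegree_le (K : Type*) [Field K] (W : ℕ) :
    Module.finrank K (MvPolynomial.restrictTotalDegree (Fin 2) K W) ≤ (W + 1) ^ 2 := by
  have hfin : Set.Finite {n : Fin 2 →₀ ℕ | (n.sum fun _ e => e) ≤ W} :=
    ((Set.Finite.pi' fun _ => Set.finite_le_nat W).preimage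
      (f := fun n : Fin 2 →₀ ℕ => (n : Fin 2 → ℕ)) DFunLike.coe_injective.injOn).subset
      fun n hn i => by
        have : n.sum (fun _ e => e) = n 0 + n 1 := by
          rw [Finsupp.sum_fintype _ _ (by simp), Fin.sum_univ_two]
        simp only [Set.mem_ofPred_eq, this] at hn
        change n i ≤ W
        fin_cases i <;> simp <;> omega
  have := hfin.fintype
  refine (Module.finrank_eq_card_basis (MvPolynomial.basisRestrictSupport K
    {n : Fin 2 →₀ ℕ | (n.sum fun _ e => e) ≤ W})).trans_le ?_
  have hcard : (W + 1) ^ 2 = Fintype.card (Fin 2 → Fin (W + 1)) := by simp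
  rw [hcard]
  refine Fintype.card_le_of_injective (fun n i => ⟨n.1 i, ?_⟩) ?_
  · have : n.1.sum (fun _ e => e) = n.1 0 + n.1 1 := by
      rw [Finsupp.sum_fintype _ _ (by simp), Fin.sum_univ_two]
    have hn := n.2
    simp only [Set.mem_ofPred_eq, this] at hn
    fin_cases i <;> simp <;> omega
  · intro a b hab
    ext i
    simpa using congrArg Fin.val (congrFun hab i)

open Polynomial in
/-- Let `s, t` be a coordinate system of the plane. Then `x` is a polynomial in `s, t` whose
`t`-degree `m` is bounded in terms of the degree of `s`: the elements `s ^ i * x ^ k * t ^ j` with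
`j < m` are linearly independent, so there cannot be too many of them of a given degree. -/
theorem natDegree_symm_X_zero_le {K : Type*} [Field K] (α : PlaneRing K ≃ₐ[K] PlaneRing K) :
    ((Polynomial.Bivariate.equivMvPolynomial K).symm (α.symm (MvPolynomial.X 0))).natDegree ≤
      ((α (MvPolynomial.X 0)).totalDegree + 2) ^ 2 := by
  set Q := (Polynomial.Bivariate.equivMvPolynomial K).symm (α.symm (MvPolynomial.X 0)) with hQ
  set s := α (MvPolynomial.X 0) with hs
  set t := α (MvPolynomial.X 1) with ht
  set m := Q.natDegree with hm
  set ρ : K[X][X] ≃ₐ[K] PlaneRing K := (Polynomial.Bivariate.equivMvPolynomial K).trans α with hρ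
  have hρs : ρ (C X) = s := by simp [hρ, hs]
  have hρt : ρ X = t := by simp [hρ, ht]
  have hρQ : ρ Q = MvPolynomial.X 0 := by simp [hρ, hQ]
  rcases Nat.eq_zero_or_pos m with h0 | hpos
  · omega
  have hQ0 : Q ≠ 0 := fun h => by simp [hm, h] at hpos
  let S : Polynomial.Sequence K[X] :=
    { elems' := fun l => Q ^ (l / m) * X ^ (l % m)
      degree_eq' := fun l => by
        rw [Polynomial.degree_mul, Polynomial.degree_pow, Polynomial.degree_X_pow,
          Polynomial.degree_eq_natDegree hQ0, ← hm]
        rw [nsmul_eq_mul]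
        norm_cast
        rw [mul_comm, Nat.div_add_mod] }
  have hX : LinearIndependent K (fun i : ℕ => (X ^ i : K[X])) := by
    have := (Polynomial.basisMonomials K).linearIndependent
    simpa [Polynomial.coe_basisMonomials, Polynomial.monomial_one_right_eq_X_pow] using this
  have hind := (linearIndependent_smul hX S.linearIndependent).map' ρ.toLinearMap
    (LinearMap.ker_eq_bot.2 ρ.injective)
  -- with this choice the degrees of the `n * (n * m)` elements below are at most `n * (e + 2) - 1`
  set e := s.totalDegree with he
  set c := m * t.totalDegree with hc
  set n := c + 1 with hn
  have hind' := hind.comp (fun p : Fin n × Fin (n * m) => ((p.1 : ℕ), (p.2 : ℕ)))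
    (fun p q h => by
      simp only [Prod.mk.injEq] at h
      exact Prod.ext (Fin.ext h.1) (Fin.ext h.2))
  have hmem : ∀ p : Fin n × Fin (n * m),
      ((ρ.toLinearMap ∘ fun p : ℕ × ℕ => (X ^ p.1 : K[X]) • S p.2) ∘
        (fun p : Fin n × Fin (n * m) => ((p.1 : ℕ), (p.2 : ℕ)))) p ∈
        MvPolynomial.restrictTotalDegree (Fin 2) K (n * e + n + c) := by
    rintro ⟨i, l⟩
    rw [MvPolynomial.mem_restrictTotalDegree]
    have hval : (ρ.toLinearMap ∘ fun p : ℕ × ℕ => (X ^ p.1 : K[X]) • S p.2) ((i : ℕ), (l : ℕ)) =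
        s ^ (i : ℕ) * (MvPolynomial.X 0 ^ ((l : ℕ) / m) * t ^ ((l : ℕ) % m)) := by
      change ρ ((X ^ (i : ℕ) : K[X]) • (Q ^ ((l : ℕ) / m) * X ^ ((l : ℕ) % m))) = _
      rw [Polynomial.smul_eq_C_mul, Polynomial.C_pow]
      simp only [map_mul, map_pow, hρs, hρt, hρQ]
    rw [Function.comp_apply, hval]
    have h1 := MvPolynomial.totalDegree_mul (s ^ (i : ℕ))
      (MvPolynomial.X 0 ^ ((l : ℕ) / m) * t ^ ((l : ℕ) % m))
    have h2 := MvPolynomial.totalDegree_mul (MvPolynomial.X 0 ^ ((l : ℕ) / m))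
      (t ^ ((l : ℕ) % m))
    have h3 : (s ^ (i : ℕ)).totalDegree ≤ i * e := MvPolynomial.totalDegree_pow s (i : ℕ)
    have h4 := MvPolynomial.totalDegree_pow t ((l : ℕ) % m)
    rw [MvPolynomial.totalDegree_X_pow] at h2
    have h5 : (i : ℕ) * e ≤ n * e := Nat.mul_le_mul_right _ i.2.le
    have h6 : (l : ℕ) % m * t.totalDegree ≤ c := Nat.mul_le_mul_right _ (Nat.mod_lt _ hpos).le
    have h7 : (l : ℕ) / m ≤ n := by
      rw [Nat.div_le_iff_le_mul_add_pred hpos]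
      have := l.2
      have : m * n = n * m := mul_comm _ _
      omega
    omega
  have hind2 : LinearIndependent K (fun p : Fin n × Fin (n * m) =>
      (⟨_, hmem p⟩ : MvPolynomial.restrictTotalDegree (Fin 2) K (n * e + n + c))) :=
    LinearIndependent.of_comp
      (MvPolynomial.restrictTotalDegree (Fin 2) K (n * e + n + c)).subtype hind'
  have hle := hind2.fintype_card_le_finrank.trans (finrank_restrictTotalDegree_le K _)
  simp only [Fintype.card_prod, Fintype.card_fin] at hle
  have hW : n * e + n + c + 1 = n * (e + 2) := by rw [hn]; ring
  rw [hW, mul_pow, ← mul_assoc, ← sq] at hle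
  exact Nat.le_of_mul_le_mul_left hle (by positivity)

/-! ### Degrees of polynomial mappings and of their inverses -/

/-- The degree of a polynomial mapping of the plane. -/
noncomputable def mapDegree {K : Type*} [Field K] (φ : PlaneEnd K) : ℕ :=
  max (φ (MvPolynomial.X 0)).totalDegree (φ (MvPolynomial.X 1)).totalDegree

theorem totalDegree_apply_le {K : Type*} [Field K] (φ : PlaneEnd K) (p : PlaneRing K) :
    (φ p).totalDegree ≤ p.totalDegree * mapDegree φ := by
  conv_lhs => rw [p.as_sum, map_sum]
  refine MvPolynomial.totalDegree_finsetSum_le fun d hd => ?_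
  have hd' := MvPolynomial.le_totalDegree hd
  rw [Finsupp.sum_fintype _ _ (by simp), Fin.sum_univ_two] at hd'
  rw [MvPolynomial.monomial_eq, Finsupp.prod_fintype _ _ (by simp), Fin.prod_univ_two, map_mul,
    map_mul, map_pow, map_pow, ← MvPolynomial.algebraMap_eq, φ.commutes,
    MvPolynomial.algebraMap_eq]
  have h1 := MvPolynomial.totalDegree_mul (MvPolynomial.C (p.coeff d))
    (φ (MvPolynomial.X 0) ^ d 0 * φ (MvPolynomial.X 1) ^ d 1)
  have h2 := MvPolynomial.totalDegree_mul (φ (MvPolynomial.X 0) ^ d 0) (φ (MvPolynomial.X 1) ^ d 1)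
  have h3 := (MvPolynomial.totalDegree_pow (φ (MvPolynomial.X 0)) (d 0)).trans
    (Nat.mul_le_mul_left _ (le_max_left _ (φ (MvPolynomial.X 1)).totalDegree))
  have h4 := (MvPolynomial.totalDegree_pow (φ (MvPolynomial.X 1)) (d 1)).trans
    (Nat.mul_le_mul_left _ (le_max_right (φ (MvPolynomial.X 0)).totalDegree _))
  have h5 := Nat.mul_le_mul_right (mapDegree φ) hd'
  rw [MvPolynomial.totalDegree_C] at h1
  rw [add_mul] at h5
  rw [mapDegree] at *
  omega

theorem mapDegree_mul_le {K : Type*} [Field K] (φ ψ : PlaneEnd K) :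
    mapDegree (φ * ψ) ≤ mapDegree ψ * mapDegree φ := by
  refine max_le ?_ ?_
  · exact (totalDegree_apply_le φ _).trans (Nat.mul_le_mul_right _ (le_max_left _ _))
  · exact (totalDegree_apply_le φ _).trans (Nat.mul_le_mul_right _ (le_max_right _ _))

/-- The coordinate swap of the plane. -/
noncomputable def planeSwap (K : Type*) [Field K] : PlaneRing K ≃ₐ[K] PlaneRing K :=
  MvPolynomial.renameEquiv K (Equiv.swap 0 1)

@[simp] theorem planeSwap_X_zero (K : Type*) [Field K] :
    planeSwap K (MvPolynomial.X 0) = MvPolynomial.X 1 := by simp [planeSwap]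

@[simp] theorem planeSwap_X_one (K : Type*) [Field K] :
    planeSwap K (MvPolynomial.X 1) = MvPolynomial.X 0 := by simp [planeSwap]

@[simp] theorem planeSwap_symm (K : Type*) [Field K] : (planeSwap K).symm = planeSwap K := by
  simp [planeSwap]

theorem totalDegree_planeSwap {K : Type*} [Field K] (p : PlaneRing K) :
    (planeSwap K p).totalDegree = p.totalDegree :=
  MvPolynomial.totalDegree_renameEquiv _ _

theorem swap_equivMvPolynomial_symm {K : Type*} [Field K] (p : PlaneRing K) :
    Polynomial.Bivariate.swap ((Polynomial.Bivariate.equivMvPolynomial K).symm p) =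
      (Polynomial.Bivariate.equivMvPolynomial K).symm (planeSwap K p) := by
  induction p using MvPolynomial.induction_on with
  | C a => simp [planeSwap, Polynomial.Bivariate.swap_C_C]
  | add p q hp hq => simp [hp, hq]
  | mul_X p i hp =>
    rw [map_mul, map_mul, map_mul, map_mul, hp]
    congr 1
    fin_cases i <;> simp [Polynomial.Bivariate.swap_X, Polynomial.Bivariate.swap_Y]

theorem totalDegree_symm_X_zero_le {K : Type*} [Field K] (α : PlaneRing K ≃ₐ[K] PlaneRing K) :
    (α.symm (MvPolynomial.X 0)).totalDegree ≤
      ((α (MvPolynomial.X 0)).totalDegree + 2) ^ 2 +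
        ((α (MvPolynomial.X 1)).totalDegree + 2) ^ 2 := by
  have h := totalDegree_equivMvPolynomial_le
    ((Polynomial.Bivariate.equivMvPolynomial K).symm (α.symm (MvPolynomial.X 0)))
  rw [AlgEquiv.apply_symm_apply, swap_equivMvPolynomial_symm] at h
  have h0 := natDegree_symm_X_zero_le α
  have h1 := natDegree_symm_X_zero_le ((planeSwap K).trans α)
  simp only [AlgEquiv.trans_apply, AlgEquiv.symm_trans_apply, planeSwap_symm,
    planeSwap_X_zero] at h1
  exact h.trans (add_le_add h0 h1)

theorem totalDegree_symm_X_one_le {K : Type*} [Field K] (α : PlaneRing K ≃ₐ[K] PlaneRing K) :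
    (α.symm (MvPolynomial.X 1)).totalDegree ≤
      ((α (MvPolynomial.X 0)).totalDegree + 2) ^ 2 +
        ((α (MvPolynomial.X 1)).totalDegree + 2) ^ 2 := by
  have h := totalDegree_symm_X_zero_le (α.trans (planeSwap K))
  simpa only [AlgEquiv.trans_apply, AlgEquiv.symm_trans_apply, planeSwap_symm,
    planeSwap_X_zero, totalDegree_planeSwap] using h

/-- The degree of the inverse of an automorphism of the plane is bounded in terms of the degree of
the automorphism. -/
theorem mapDegree_symm_le {K : Type*} [Field K] (α : PlaneRing K ≃ₐ[K] PlaneRing K) :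
    mapDegree (α.symm : PlaneEnd K) ≤ 2 * (mapDegree (α : PlaneEnd K) + 2) ^ 2 := by
  have h0 : (α (MvPolynomial.X 0)).totalDegree ≤ mapDegree (α : PlaneEnd K) := le_max_left _ _
  have h1 : (α (MvPolynomial.X 1)).totalDegree ≤ mapDegree (α : PlaneEnd K) := le_max_right _ _
  have h2 := Nat.pow_le_pow_left (Nat.add_le_add_right h0 2) 2
  have h3 := Nat.pow_le_pow_left (Nat.add_le_add_right h1 2) 2
  have h4 := totalDegree_symm_X_zero_le α
  have h5 := totalDegree_symm_X_one_le α
  refine max_le ?_ ?_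
  · change (α.symm (MvPolynomial.X 0)).totalDegree ≤ _
    omega
  · change (α.symm (MvPolynomial.X 1)).totalDegree ≤ _
    omega

/-! ### The Jacobian determinant -/

/-- The Jacobian determinant of a polynomial mapping of the plane. -/
noncomputable def jacobian {K : Type*} [Field K] (φ : PlaneEnd K) : PlaneRing K :=
  MvPolynomial.pderiv 0 (φ (MvPolynomial.X 0)) * MvPolynomial.pderiv 1 (φ (MvPolynomial.X 1)) -
    MvPolynomial.pderiv 1 (φ (MvPolynomial.X 0)) * MvPolynomial.pderiv 0 (φ (MvPolynomial.X 1))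

theorem pderiv_apply {K : Type*} [Field K] (φ : PlaneEnd K) (i : Fin 2) (p : PlaneRing K) :
    MvPolynomial.pderiv i (φ p) =
      φ (MvPolynomial.pderiv 0 p) * MvPolynomial.pderiv i (φ (MvPolynomial.X 0)) +
        φ (MvPolynomial.pderiv 1 p) * MvPolynomial.pderiv i (φ (MvPolynomial.X 1)) := by
  induction p using MvPolynomial.induction_on with
  | C a =>
    rw [← MvPolynomial.algebraMap_eq, φ.commutes]
    simp [MvPolynomial.algebraMap_eq]
  | add p q hp hq =>
    simp only [map_add, hp, hq]
    ring
  | mul_X p j hp =>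
    simp only [map_mul, MvPolynomial.pderiv_mul, hp, map_add]
    fin_cases j <;> simp [MvPolynomial.pderiv_X] <;> ring

theorem jacobian_mul {K : Type*} [Field K] (φ ψ : PlaneEnd K) :
    jacobian (φ * ψ) = jacobian φ * φ (jacobian ψ) := by
  simp only [jacobian, AlgHom.mul_apply, map_sub, map_mul]
  rw [pderiv_apply φ 0 (ψ (MvPolynomial.X 0)), pderiv_apply φ 1 (ψ (MvPolynomial.X 0)),
    pderiv_apply φ 0 (ψ (MvPolynomial.X 1)), pderiv_apply φ 1 (ψ (MvPolynomial.X 1))]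
  ring

theorem jacobian_one {K : Type*} [Field K] : jacobian (1 : PlaneEnd K) = 1 := by
  simp [jacobian, MvPolynomial.pderiv_X]

theorem jacobian_contractionX {K : Type*} [Field K] :
    jacobian (contractionX K) = MvPolynomial.X 0 := by
  simp [jacobian, contractionX, MvPolynomial.pderiv_X]

/-- The Jacobian determinant of an automorphism is a nonzero constant. -/
theorem exists_jacobian_eq_C {K : Type*} [Field K] (α : PlaneRing K ≃ₐ[K] PlaneRing K) :
    ∃ j : K, j ≠ 0 ∧ jacobian (α : PlaneEnd K) = MvPolynomial.C j := by
  have h : jacobian ((α : PlaneEnd K) * (α.symm : PlaneEnd K)) = 1 := by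
    rw [← jacobian_one]
    congr 1
    ext i
    simp
  rw [jacobian_mul] at h
  have hu : IsUnit (jacobian (α : PlaneEnd K)) := IsUnit.of_mul_eq_one _ h
  obtain ⟨j, hj, h'⟩ := MvPolynomial.isUnit_iff_eq_C_of_isReduced.1 hu
  exact ⟨j, hj.ne_zero, h'⟩

theorem totalDegree_pderiv_le {K : Type*} [Field K] (i : Fin 2) (p : PlaneRing K) :
    (MvPolynomial.pderiv i p).totalDegree ≤ p.totalDegree := by
  conv_lhs => rw [p.as_sum, map_sum]
  refine MvPolynomial.totalDegree_finsetSum_le fun d hd => ?_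
  rw [MvPolynomial.pderiv_monomial]
  refine (MvPolynomial.totalDegree_monomial_le _ _).trans
    (le_trans ?_ (MvPolynomial.le_totalDegree hd))
  rw [Finsupp.sum_fintype _ _ (by simp), Finsupp.sum_fintype _ _ (by simp)]
  exact Finset.sum_le_sum fun j _ => by simp

theorem totalDegree_jacobian_le {K : Type*} [Field K] (φ : PlaneEnd K) :
    (jacobian φ).totalDegree ≤ 2 * mapDegree φ := by
  have key : ∀ i j : Fin 2, (MvPolynomial.pderiv i (φ (MvPolynomial.X 0)) *
      MvPolynomial.pderiv j (φ (MvPolynomial.X 1))).totalDegree ≤ 2 * mapDegree φ := by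
    intro i j
    have h := MvPolynomial.totalDegree_mul (MvPolynomial.pderiv i (φ (MvPolynomial.X 0)))
      (MvPolynomial.pderiv j (φ (MvPolynomial.X 1)))
    have h0 := (totalDegree_pderiv_le i (φ (MvPolynomial.X 0))).trans
      (le_max_left _ (φ (MvPolynomial.X 1)).totalDegree)
    have h1 := (totalDegree_pderiv_le j (φ (MvPolynomial.X 1))).trans
      (le_max_right (φ (MvPolynomial.X 0)).totalDegree _)
    rw [mapDegree]
    omega
  exact (MvPolynomial.totalDegree_sub _ _).trans (max_le (key 0 1) (key 1 0))

/-! ### A complementary coordinate of small degree -/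

open Polynomial in
/-- For a nonconstant polynomial `s`, the degree of `b(s)` is the expected one. -/
theorem totalDegree_aeval_eq {K : Type*} [Field K] {s : PlaneRing K} (hs : s.totalDegree ≠ 0)
    {b : K[X]} (hb : b ≠ 0) : (aeval s b).totalDegree = b.natDegree * s.totalDegree := by
  have hs0 : s ≠ 0 := fun h => hs (by simp [h])
  have hpow : ∀ n : ℕ, (s ^ n).totalDegree = n * s.totalDegree := by
    intro n
    induction n with
    | zero => simp
    | succ n ih =>
      rw [pow_succ, MvPolynomial.totalDegree_mul_of_isDomain (pow_ne_zero n hs0) hs0, ih]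
      ring
  have hterm : ∀ (a : K) (n : ℕ), a ≠ 0 →
      (MvPolynomial.C a * s ^ n).totalDegree = n * s.totalDegree := by
    intro a n ha
    rw [MvPolynomial.totalDegree_mul_of_isDomain (by simpa using ha) (pow_ne_zero n hs0), hpow,
      MvPolynomial.totalDegree_C, zero_add]
  rw [aeval_eq_sum_range, Finset.sum_range_succ]
  simp only [MvPolynomial.smul_eq_C_mul]
  have hlead := hterm (b.coeff b.natDegree) b.natDegree (by simpa using hb)
  rcases Nat.eq_zero_or_pos b.natDegree with h0 | hpos
  · rw [← hlead, h0]
    simp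
  rw [MvPolynomial.totalDegree_add_eq_right_of_totalDegree_lt, hlead]
  rw [hlead]
  have hspos := Nat.pos_of_ne_zero hs
  refine lt_of_le_of_lt (MvPolynomial.totalDegree_finsetSum_le
    (d := (b.natDegree - 1) * s.totalDegree) fun i hi => ?_)
    (Nat.mul_lt_mul_of_pos_right (by omega) hspos)
  rw [Finset.mem_range] at hi
  by_cases hc : b.coeff i = 0
  · simp [hc]
  · rw [hterm _ _ hc]
    exact Nat.mul_le_mul_right _ (by omega)

theorem totalDegree_apply_ne_zero {K : Type*} [Field K] {φ : PlaneEnd K}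
    (hφ : Function.Injective φ) {p : PlaneRing K} (hp : p.totalDegree ≠ 0) :
    (φ p).totalDegree ≠ 0 := by
  intro h
  rw [MvPolynomial.totalDegree_eq_zero_iff_eq_C] at h
  have : p = MvPolynomial.C ((φ p).coeff 0) := by
    apply hφ
    conv_lhs => rw [h]
    rw [← MvPolynomial.algebraMap_eq, φ.commutes]
  exact hp (by rw [this, MvPolynomial.totalDegree_C])

/-- If `s, t` is a coordinate system of the plane, then some coordinate system `s, t + q(s)` has
a degree that is bounded in terms of the degree of `s` alone. Up to a constant factor the
derivation `D = J(s, ·)` is the partial derivative with respect to `t`; applied repeatedly to `x`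
(or to `y`) it yields an element `b(s) * t + a(s)` of bounded degree, and the quotient of `a` by
`b` is removed. -/
theorem exists_totalDegree_add_aeval_le {K : Type*} [Field K] [CharZero K]
    (α : PlaneRing K ≃ₐ[K] PlaneRing K) :
    ∃ q : Polynomial K,
      (α (MvPolynomial.X 1) + Polynomial.aeval (α (MvPolynomial.X 0)) q).totalDegree ≤
        1 + ((α (MvPolynomial.X 0)).totalDegree + 2) ^ 2 *
          (α (MvPolynomial.X 0)).totalDegree := by
  set s := α (MvPolynomial.X 0) with hs
  set t := α (MvPolynomial.X 1) with ht
  set e := s.totalDegree with he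
  set E := Polynomial.Bivariate.equivMvPolynomial K with hE
  have hs_deg : e ≠ 0 := by
    refine totalDegree_apply_ne_zero (φ := (α : PlaneEnd K)) α.injective ?_
    simp
  -- one of `x`, `y` involves `t`
  obtain ⟨i, hi0, hile⟩ : ∃ i : Fin 2, (E.symm (α.symm (MvPolynomial.X i))).natDegree ≠ 0 ∧
      (E.symm (α.symm (MvPolynomial.X i))).natDegree ≤ (e + 2) ^ 2 := by
    have hle0 := natDegree_symm_X_zero_le α
    have hle1 := natDegree_symm_X_zero_le (α.trans (planeSwap K))
    simp only [AlgEquiv.trans_apply, AlgEquiv.symm_trans_apply, planeSwap_symm,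
      planeSwap_X_zero, totalDegree_planeSwap] at hle1
    by_contra! hcon
    have hz0 : (E.symm (α.symm (MvPolynomial.X 0))).natDegree = 0 := by
      by_contra h
      exact absurd hle0 (not_le.2 (hcon 0 h))
    have hz1 : (E.symm (α.symm (MvPolynomial.X 1))).natDegree = 0 := by
      by_contra h
      exact absurd hle1 (not_le.2 (hcon 1 h))
    have hall : ∀ p : PlaneRing K, (E.symm (α.symm p)).natDegree = 0 := by
      intro p
      induction p using MvPolynomial.induction_on with
      | C a =>
        rw [← MvPolynomial.algebraMap_eq, AlgEquiv.commutes, AlgEquiv.commutes]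
        exact Polynomial.natDegree_C _
      | add p q hp hq =>
        rw [map_add, map_add]
        exact Nat.le_zero.1 ((Polynomial.natDegree_add_le _ _).trans (by simp [hp, hq]))
      | mul_X p j hp =>
        rw [map_mul, map_mul]
        refine Nat.le_zero.1 (Polynomial.natDegree_mul_le.trans ?_)
        fin_cases j
        · simpa [hp] using hz0
        · simpa [hp] using hz1
    have := hall (α (E Polynomial.X))
    simp at this
  set P := E.symm (α.symm (MvPolynomial.X i)) with hP
  set m := P.natDegree with hm
  obtain ⟨j, hj0, hj⟩ := exists_jacobian_eq_C α
  set D : Derivation K (PlaneRing K) (PlaneRing K) :=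
    MvPolynomial.pderiv 0 s • MvPolynomial.pderiv 1 -
      MvPolynomial.pderiv 1 s • MvPolynomial.pderiv 0 with hD
  have hDapply : ∀ Q : Polynomial (Polynomial K),
      D (α (E Q)) = MvPolynomial.C j * α (E (Polynomial.derivative Q)) := by
    intro Q
    rw [← hj, ← Polynomial.Bivariate.pderiv_one_equivMvPolynomial]
    have h : ∀ k : Fin 2, MvPolynomial.pderiv k (α (E Q)) =
        α (MvPolynomial.pderiv 0 (E Q)) * MvPolynomial.pderiv k s +
          α (MvPolynomial.pderiv 1 (E Q)) * MvPolynomial.pderiv k t :=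
      fun k => pderiv_apply (α : PlaneEnd K) k (E Q)
    have hjac : jacobian (α : PlaneEnd K) = MvPolynomial.pderiv 0 s * MvPolynomial.pderiv 1 t -
        MvPolynomial.pderiv 1 s * MvPolynomial.pderiv 0 t := rfl
    rw [hjac]
    simp only [hD, Derivation.sub_apply, Derivation.smul_apply, smul_eq_mul, h]
    ring
  have hDiter : ∀ (k : ℕ) (Q : Polynomial (Polynomial K)),
      D^[k] (α (E Q)) = MvPolynomial.C (j ^ k) * α (E (Polynomial.derivative^[k] Q)) := by
    intro k
    induction k with
    | zero => simp
    | succ k ih =>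
      intro Q
      rw [Function.iterate_succ_apply', ih, Function.iterate_succ_apply', MvPolynomial.C_mul',
        Derivation.map_smul, hDapply, MvPolynomial.C_mul', MvPolynomial.C_mul', smul_smul, pow_succ]
  have hDdeg : ∀ p : PlaneRing K, (D p).totalDegree ≤ p.totalDegree + e := by
    intro p
    have key : ∀ a b : Fin 2, (MvPolynomial.pderiv a s * MvPolynomial.pderiv b p).totalDegree ≤
        p.totalDegree + e := fun a b => by
      have := MvPolynomial.totalDegree_mul (MvPolynomial.pderiv a s) (MvPolynomial.pderiv b p)
      have h1 := totalDegree_pderiv_le a s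
      have h2 := totalDegree_pderiv_le b p
      omega
    exact (MvPolynomial.totalDegree_sub _ _).trans (max_le (key 0 1) (key 1 0))
  have hDiterdeg : ∀ k : ℕ, (D^[k] (MvPolynomial.X i)).totalDegree ≤ 1 + k * e := by
    intro k
    induction k with
    | zero => simp
    | succ k ih =>
      rw [Function.iterate_succ_apply']
      have := hDdeg (D^[k] (MvPolynomial.X i))
      rw [add_mul]
      omega
  -- `w = b(s) * t + a(s)`
  set R := Polynomial.derivative^[m - 1] P with hR
  have hRdeg : R.natDegree ≤ 1 := by
    have := Polynomial.natDegree_iterate_derivative P (m - 1)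
    rw [hR]
    omega
  obtain ⟨b, a, hba⟩ := Polynomial.exists_eq_X_add_C_of_natDegree_le_one hRdeg
  have hb0 : b ≠ 0 := by
    have h1 : R.coeff 1 = b := by rw [hba]; simp
    rw [← h1, hR, Polynomial.coeff_iterate_derivative]
    have hm1 : 1 + (m - 1) = m := by omega
    rw [hm1, smul_ne_zero_iff]
    refine ⟨?_, ?_⟩
    · rw [Ne, Nat.descFactorial_eq_zero_iff_lt]
      omega
    · rw [hm, Polynomial.coeff_natDegree]
      intro h
      rw [Polynomial.leadingCoeff_eq_zero] at h
      rw [hm, h] at hi0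
      simp at hi0
  have hEC : ∀ f : Polynomial K, α (E (Polynomial.C f)) = Polynomial.aeval s f := by
    intro f
    induction f using Polynomial.induction_on' with
    | add p q hp hq => simp only [map_add, hp, hq]
    | monomial n r =>
      rw [← Polynomial.C_mul_X_pow_eq_monomial]
      simp only [map_mul, map_pow, hE, Polynomial.Bivariate.equivMvPolynomial_C_C,
        Polynomial.Bivariate.equivMvPolynomial_C_X, Polynomial.aeval_C, Polynomial.aeval_X, hs]
      rw [← MvPolynomial.algebraMap_eq, α.commutes]
  have hRval : α (E R) = Polynomial.aeval s b * t + Polynomial.aeval s a := by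
    rw [hba, map_add, map_add, map_mul, map_mul, hEC, hEC]
    simp [hE, ht]
  have hw : (Polynomial.aeval s b * t + Polynomial.aeval s a).totalDegree ≤ 1 + (m - 1) * e := by
    rw [← hRval]
    have h1 := hDiter (m - 1) P
    rw [hP, AlgEquiv.apply_symm_apply, AlgEquiv.apply_symm_apply] at h1
    have h2 : α (E R) = MvPolynomial.C ((j ^ (m - 1))⁻¹) * D^[m - 1] (MvPolynomial.X i) := by
      rw [h1, ← mul_assoc, ← MvPolynomial.C_mul, inv_mul_cancel₀ (pow_ne_zero _ hj0)]
      simp [hR, hP]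
    rw [h2]
    refine (MvPolynomial.totalDegree_mul _ _).trans ?_
    rw [MvPolynomial.totalDegree_C, zero_add]
    exact hDiterdeg _
  have hbs_deg : (Polynomial.aeval s b).totalDegree ≤ 1 + m * e := by
    have h1 : D (Polynomial.aeval s b * t + Polynomial.aeval s a) =
        MvPolynomial.C j * Polynomial.aeval s b := by
      rw [← hRval, hDapply, hba]
      simp [hEC]
    have h2 : Polynomial.aeval s b = MvPolynomial.C j⁻¹ *
        D (Polynomial.aeval s b * t + Polynomial.aeval s a) := by
      rw [h1, ← mul_assoc, ← MvPolynomial.C_mul, inv_mul_cancel₀ hj0]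
      simp
    rw [h2]
    refine (MvPolynomial.totalDegree_mul _ _).trans ?_
    rw [MvPolynomial.totalDegree_C, zero_add]
    have h3 := hDdeg (Polynomial.aeval s b * t + Polynomial.aeval s a)
    have h4 : (m - 1) * e + e = m * e := by
      obtain ⟨k, hk⟩ := Nat.exists_eq_succ_of_ne_zero hi0
      rw [hk]
      simp [Nat.succ_mul]
    omega
  refine ⟨a / b, ?_⟩
  have hbs0 : Polynomial.aeval s b ≠ 0 := by
    intro h
    have h1 : α (E (Polynomial.C b)) = 0 := by rw [hEC, h]
    simp [hb0] at h1
  have hprod : Polynomial.aeval s b * (t + Polynomial.aeval s (a / b)) =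
      (Polynomial.aeval s b * t + Polynomial.aeval s a) - Polynomial.aeval s (a % b) := by
    have h := congrArg (Polynomial.aeval s) (EuclideanDomain.div_add_mod a b)
    rw [map_add, map_mul] at h
    linear_combination h
  have hrem : (Polynomial.aeval s (a % b)).totalDegree ≤ 1 + m * e := by
    by_cases hr : a % b = 0
    · simp [hr]
    · rw [totalDegree_aeval_eq hs_deg hr]
      rw [totalDegree_aeval_eq hs_deg hb0] at hbs_deg
      refine le_trans (Nat.mul_le_mul_right _ ?_) hbs_deg
      exact Polynomial.natDegree_le_natDegree (Polynomial.degree_mod_lt a hb0).le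
  have hfin : (Polynomial.aeval s b * (t + Polynomial.aeval s (a / b))).totalDegree ≤
      1 + m * e := by
    rw [hprod]
    refine (MvPolynomial.totalDegree_sub _ _).trans (max_le (hw.trans ?_) hrem)
    exact Nat.add_le_add_left (Nat.mul_le_mul_right _ (Nat.sub_le _ _)) _
  have hfin2 : (t + Polynomial.aeval s (a / b)).totalDegree ≤ 1 + m * e := by
    by_cases h0 : t + Polynomial.aeval s (a / b) = 0
    · simp [h0]
    · rw [MvPolynomial.totalDegree_mul_of_isDomain hbs0 h0] at hfin
      omega
  exact hfin2.trans (Nat.add_le_add_left (Nat.mul_le_mul_right _ hile) _)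

/-! ### Factorisations of bounded degree -/

/-- The exponent of `τ(x ^ a * y ^ b) = x ^ (a + b) * y ^ b`, where `τ` is the contraction. -/
noncomputable def contractionExponent (d : Fin 2 →₀ ℕ) : Fin 2 →₀ ℕ := d + Finsupp.single 0 (d 1)

theorem contractionExponent_injective : Function.Injective contractionExponent := by
  intro d d' h
  have h0 := DFunLike.congr_fun h 0
  have h1 := DFunLike.congr_fun h 1
  simp [contractionExponent] at h0 h1
  ext i
  fin_cases i <;> simp <;> omega

theorem coeff_contractionX {K : Type*} [Field K] (p : PlaneRing K) (d : Fin 2 →₀ ℕ) :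
    (contractionX K p).coeff (contractionExponent d) = p.coeff d := by
  induction p using MvPolynomial.induction_on' with
  | add p q hp hq => simp [hp, hq]
  | monomial d' r =>
    have h : contractionX K (MvPolynomial.monomial d' r) =
        MvPolynomial.monomial (contractionExponent d') r := by
      rw [contractionX, MvPolynomial.aeval_monomial, MvPolynomial.monomial_eq,
        Finsupp.prod_fintype _ _ (by simp), Finsupp.prod_fintype _ _ (by simp)]
      simp only [contractionExponent, MvPolynomial.algebraMap_eq, Fin.prod_univ_two,
        Matrix.cons_val_zero, Matrix.cons_val_one, Finsupp.add_apply, Finsupp.single_apply]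
      simp only [if_true, zero_ne_one, if_false]
      ring
    rw [h, MvPolynomial.coeff_monomial, MvPolynomial.coeff_monomial]
    simp only [contractionExponent_injective.eq_iff]

theorem contractionX_injective {K : Type*} [Field K] : Function.Injective (contractionX K) := by
  rw [injective_iff_map_eq_zero]
  intro p hp
  ext d
  rw [← coeff_contractionX, hp]
  simp

theorem totalDegree_le_contractionX {K : Type*} [Field K] (p : PlaneRing K) :
    p.totalDegree ≤ (contractionX K p).totalDegree := by
  refine Finset.sup_le fun d hd => ?_
  have h : contractionExponent d ∈ (contractionX K p).support := by
    rw [MvPolynomial.mem_support_iff, coeff_contractionX]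
    exact MvPolynomial.mem_support_iff.1 hd
  refine le_trans ?_ (MvPolynomial.le_totalDegree h)
  rw [Finsupp.sum_fintype _ _ (by simp), Finsupp.sum_fintype _ _ (by simp), Fin.sum_univ_two,
    Fin.sum_univ_two]
  simp [contractionExponent]

/-- `HasContractions n φ`: the mapping `φ` is a product of automorphisms and of exactly `n` copies
of the contraction `x ↦ x`, `y ↦ x * y`. -/
inductive HasContractions {K : Type*} [Field K] : ℕ → PlaneEnd K → Prop
  | aut (α : PlaneRing K ≃ₐ[K] PlaneRing K) : HasContractions 0 (α : PlaneEnd K)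
  | step (α : PlaneRing K ≃ₐ[K] PlaneRing K) {n : ℕ} {ψ : PlaneEnd K} (h : HasContractions n ψ) :
      HasContractions (n + 1) ((α : PlaneEnd K) * contractionX K * ψ)

theorem HasContractions.aut_mul {K : Type*} [Field K] {n : ℕ} {φ : PlaneEnd K}
    (h : HasContractions n φ) (β : PlaneRing K ≃ₐ[K] PlaneRing K) :
    HasContractions n ((β : PlaneEnd K) * φ) := by
  cases h with
  | aut α => exact HasContractions.aut (α.trans β)
  | step α h => exact HasContractions.step (α.trans β) h

theorem IsProductOfSimpleAffineContractions.exists_hasContractions {K : Type*} [Field K]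
    {φ : PlaneEnd K} (h : IsProductOfSimpleAffineContractions φ) :
    ∃ n, HasContractions n φ := by
  refine Submonoid.closure_induction_left (motive := fun φ _ => ∃ n, HasContractions n φ)
    ⟨0, HasContractions.aut AlgEquiv.refl⟩ ?_ h
  rintro ψ hψ φ - ⟨n, hn⟩
  rcases hψ with hψ | rfl
  · exact ⟨n, hn.aut_mul (AlgEquiv.ofBijective ψ hψ)⟩
  · exact ⟨n + 1, HasContractions.step AlgEquiv.refl hn⟩

/-- Every contraction contributes a nonconstant factor to the Jacobian determinant. In the
induction over the product, the injective mapping `θ` stands for the factors to the left. -/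
theorem HasContractions.jacobian_ne_zero_and_le_totalDegree {K : Type*} [Field K] {n : ℕ}
    {φ : PlaneEnd K} (h : HasContractions n φ) :
    jacobian φ ≠ 0 ∧ ∀ θ : PlaneEnd K, Function.Injective θ → n ≤ (θ (jacobian φ)).totalDegree := by
  induction h with
  | aut α =>
    obtain ⟨j, hj0, hj⟩ := exists_jacobian_eq_C α
    rw [hj]
    exact ⟨by simpa using hj0, fun _ _ => Nat.zero_le _⟩
  | @step α n ψ h ih =>
    obtain ⟨j, hj0, hj⟩ := exists_jacobian_eq_C α
    have hinj : Function.Injective ((α : PlaneEnd K) * contractionX K) :=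
      α.injective.comp contractionX_injective
    have hjac : jacobian ((α : PlaneEnd K) * contractionX K * ψ) =
        MvPolynomial.C j * α (MvPolynomial.X 0) *
          ((α : PlaneEnd K) * contractionX K) (jacobian ψ) := by
      rw [jacobian_mul, jacobian_mul, hj, jacobian_contractionX]
      rfl
    have hC : MvPolynomial.C j * α (MvPolynomial.X 0) ≠ 0 := by
      simp [hj0]
    have hψ : ((α : PlaneEnd K) * contractionX K) (jacobian ψ) ≠ 0 :=
      fun h0 => ih.1 (hinj (h0.trans (map_zero _).symm))
    refine ⟨by rw [hjac]; exact mul_ne_zero hC hψ, fun θ hθ => ?_⟩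
    have hθ0 : ∀ p : PlaneRing K, p ≠ 0 → θ p ≠ 0 :=
      fun p hp h0 => hp (hθ (h0.trans (map_zero _).symm))
    rw [hjac, map_mul, MvPolynomial.totalDegree_mul_of_isDomain (hθ0 _ hC) (hθ0 _ hψ), map_mul,
      ← MvPolynomial.algebraMap_eq, θ.commutes, MvPolynomial.algebraMap_eq,
      MvPolynomial.totalDegree_mul_of_isDomain (by simpa using hj0) (hθ0 _ (by simp)),
      MvPolynomial.totalDegree_C]
    have h1 := ih.2 (θ * ((α : PlaneEnd K) * contractionX K)) (hθ.comp hinj)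
    have h2 : (θ (α (MvPolynomial.X 0))).totalDegree ≠ 0 :=
      totalDegree_apply_ne_zero (φ := θ * (α : PlaneEnd K)) (p := MvPolynomial.X 0)
        (hθ.comp α.injective) (by simp)
    rw [AlgHom.mul_apply] at h1
    omega

/-- The number of contractions in a product is bounded by the degree of its Jacobian
determinant. -/
theorem HasContractions.le_two_mul_mapDegree {K : Type*} [Field K] {n : ℕ} {φ : PlaneEnd K}
    (h : HasContractions n φ) : n ≤ 2 * mapDegree φ :=
  (h.jacobian_ne_zero_and_le_totalDegree.2 1 Function.injective_id).trans
    (totalDegree_jacobian_le φ)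

/-- The first coordinate of the leftmost automorphism of a product divides the Jacobian
determinant. -/
theorem HasContractions.totalDegree_le {K : Type*} [Field K] {n : ℕ}
    {α : PlaneRing K ≃ₐ[K] PlaneRing K} {ψ : PlaneEnd K} (h : HasContractions n ψ) :
    (α (MvPolynomial.X 0)).totalDegree ≤
      2 * mapDegree ((α : PlaneEnd K) * contractionX K * ψ) := by
  have hne := (HasContractions.step α h).jacobian_ne_zero_and_le_totalDegree.1
  refine le_trans ?_ (totalDegree_jacobian_le _)
  refine MvPolynomial.totalDegree_le_of_dvd_of_isDomain ?_ hne
  obtain ⟨j, hj0, hj⟩ := exists_jacobian_eq_C α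
  rw [jacobian_mul, jacobian_mul, jacobian_contractionX]
  exact Dvd.dvd.mul_right (Dvd.intro_left _ rfl) _

/-- The mapping `x ↦ x`, `y ↦ (e * x + 1 - e) * y`. It is the identity for `e = 0` and the
contraction for `e = 1`, and a product of simple affine contractions for every `e`. -/
noncomputable def partialContraction {K : Type*} [Field K] (e : K) : PlaneEnd K :=
  MvPolynomial.aeval ![MvPolynomial.X 0,
    (MvPolynomial.C e * MvPolynomial.X 0 + MvPolynomial.C (1 - e)) * MvPolynomial.X 1]

theorem partialContraction_zero {K : Type*} [Field K] :
    partialContraction (0 : K) = 1 := by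
  ext i
  fin_cases i <;> simp [partialContraction]

theorem partialContraction_one {K : Type*} [Field K] :
    partialContraction (1 : K) = contractionX K := by
  ext i
  fin_cases i <;> simp [partialContraction, contractionX]

/-- The triangular automorphism `x ↦ x`, `y ↦ y + q(x)`. -/
noncomputable def triangular {K : Type*} [Field K] (q : Polynomial K) :
    PlaneRing K ≃ₐ[K] PlaneRing K :=
  AlgEquiv.ofAlgHom
    (MvPolynomial.aeval ![MvPolynomial.X 0,
      MvPolynomial.X 1 + Polynomial.aeval (MvPolynomial.X 0) q])
    (MvPolynomial.aeval ![MvPolynomial.X 0,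
      MvPolynomial.X 1 - Polynomial.aeval (MvPolynomial.X 0) q])
    (by
      ext i
      fin_cases i
      · simp
      · simp [← Polynomial.aeval_algHom_apply])
    (by
      ext i
      fin_cases i
      · simp
      · simp [← Polynomial.aeval_algHom_apply])

theorem algEquiv_aeval {K : Type*} [Field K] (α : PlaneRing K ≃ₐ[K] PlaneRing K)
    (s : PlaneRing K) (q : Polynomial K) : α (Polynomial.aeval s q) = Polynomial.aeval (α s) q :=
  (Polynomial.aeval_algHom_apply (α : PlaneRing K →ₐ[K] PlaneRing K) s q).symm

theorem triangular_X_zero {K : Type*} [Field K] (q : Polynomial K) :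
    triangular q (MvPolynomial.X 0) = MvPolynomial.X 0 := by
  simp [triangular]

theorem triangular_X_one {K : Type*} [Field K] (q : Polynomial K) :
    triangular q (MvPolynomial.X 1) =
      MvPolynomial.X 1 + Polynomial.aeval (MvPolynomial.X 0) q := by
  simp [triangular]

/-- A triangular automorphism can be moved past the contraction. -/
theorem contractionX_eq_triangular_mul {K : Type*} [Field K] (q : Polynomial K) :
    contractionX K = (triangular q : PlaneEnd K) * contractionX K *
      (triangular (-(Polynomial.X * q)) : PlaneEnd K) := by
  ext i
  fin_cases i
  · simp [triangular_X_zero, contractionX]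
  · simp [triangular_X_zero, triangular_X_one, contractionX, ← Polynomial.aeval_algHom_apply,
      mul_add]

/-- A bound for the degree of the remaining factor after a contraction has been split off a
mapping of degree `D`. -/
def degreeGrowth (D : ℕ) : ℕ := (D + 1) * (2 * ((2 * D + 2) ^ 3 + 2) ^ 2)

theorem le_degreeGrowth (D : ℕ) : D ≤ degreeGrowth D := by
  have h : D * 1 ≤ (D + 1) * (2 * ((2 * D + 2) ^ 3 + 2) ^ 2) :=
    Nat.mul_le_mul (Nat.le_succ D) (Nat.succ_le_of_lt (by positivity))
  simpa [degreeGrowth] using h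

/-- `BoundedProduct B m φ`: the mapping `φ` is a product of `m` factors of the form
`α * partialContraction e`, where the automorphisms `α` and their inverses have degree at most
`B`. -/
inductive BoundedProduct {K : Type*} [Field K] (B : ℕ) : ℕ → PlaneEnd K → Prop
  | one : BoundedProduct B 0 1
  | mul (α : PlaneRing K ≃ₐ[K] PlaneRing K) (e : K) {m : ℕ} {ψ : PlaneEnd K}
      (hα : mapDegree (α : PlaneEnd K) ≤ B) (hα' : mapDegree (α.symm : PlaneEnd K) ≤ B)
      (h : BoundedProduct B m ψ) :
      BoundedProduct B (m + 1) ((α : PlaneEnd K) * partialContraction e * ψ)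

theorem mapDegree_refl {K : Type*} [Field K] :
    mapDegree ((AlgEquiv.refl : PlaneRing K ≃ₐ[K] PlaneRing K) : PlaneEnd K) = 1 := by
  simp [mapDegree]

theorem BoundedProduct.succ {K : Type*} [Field K] {B m : ℕ} {φ : PlaneEnd K} (hB : 1 ≤ B)
    (h : BoundedProduct B m φ) : BoundedProduct B (m + 1) φ := by
  induction h with
  | one =>
    have := BoundedProduct.mul (K := K) (B := B) AlgEquiv.refl 0 (by rwa [mapDegree_refl])
      (by rw [AlgEquiv.refl_symm]; rwa [mapDegree_refl]) BoundedProduct.one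
    rw [partialContraction_zero] at this
    exact this
  | mul α e hα hα' h ih => exact BoundedProduct.mul α e hα hα' ih

theorem BoundedProduct.mono {K : Type*} [Field K] {B B' m : ℕ} {φ : PlaneEnd K} (hB : B ≤ B')
    (h : BoundedProduct B m φ) : BoundedProduct B' m φ := by
  induction h with
  | one => exact BoundedProduct.one
  | mul α e hα hα' h ih => exact BoundedProduct.mul α e (hα.trans hB) (hα'.trans hB) ih

/-- A product of simple affine contractions has a factorisation whose degrees are bounded. The
leftmost automorphism `(s, t)` may be replaced by `(s, t + q(s))`; since `s` divides the Jacobian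
determinant, a suitable choice of `q` bounds its degree. -/
theorem HasContractions.boundedProduct {K : Type*} [Field K] [CharZero K] {n : ℕ}
    {φ : PlaneEnd K} (h : HasContractions n φ) :
    ∀ D : ℕ, mapDegree φ ≤ D → BoundedProduct (degreeGrowth^[n + 1] D) (n + 1) φ := by
  induction n generalizing φ with
  | zero =>
    intro D hD
    cases h with
    | aut α =>
      have h1 : mapDegree (α.symm : PlaneEnd K) ≤ degreeGrowth D := by
        refine (mapDegree_symm_le α).trans ?_
        have h2 : 2 * (mapDegree (α : PlaneEnd K) + 2) ^ 2 ≤ 1 * (2 * ((2 * D + 2) ^ 3 + 2) ^ 2) := by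
          rw [one_mul]
          have h3 : mapDegree (α : PlaneEnd K) ≤ (2 * D + 2) ^ 3 := by
            have h4 : 2 * D + 2 ≤ (2 * D + 2) ^ 3 := Nat.le_self_pow (by omega) _
            omega
          gcongr
        exact h2.trans (Nat.mul_le_mul_right _ (by omega))
      have := BoundedProduct.mul (B := degreeGrowth D) α 0 (hD.trans (le_degreeGrowth D)) h1
        BoundedProduct.one
      rw [partialContraction_zero] at this
      exact this
  | succ n ih =>
    intro D hD
    cases h with
    | @step α _ ψ h =>
      obtain ⟨q, hq⟩ := exists_totalDegree_add_aeval_le α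
      have hs : (α (MvPolynomial.X 0)).totalDegree ≤ 2 * D :=
        h.totalDegree_le.trans (Nat.mul_le_mul_left 2 hD)
      set α' : PlaneRing K ≃ₐ[K] PlaneRing K := (triangular q).trans α with hα'
      set ψ' : PlaneEnd K := (triangular (-(Polynomial.X * q)) : PlaneEnd K) * ψ with hψ'
      have hφ : (α : PlaneEnd K) * contractionX K * ψ =
          (α' : PlaneEnd K) * contractionX K * ψ' := by
        conv_lhs => rw [contractionX_eq_triangular_mul q]
        rfl
      have hdeg : mapDegree (α' : PlaneEnd K) ≤ (2 * D + 2) ^ 3 := by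
        refine max_le ?_ ?_
        · change (α (triangular q (MvPolynomial.X 0))).totalDegree ≤ _
          rw [triangular_X_zero]
          have h4 : 2 * D + 2 ≤ (2 * D + 2) ^ 3 := Nat.le_self_pow (by omega) _
          omega
        · change (α (triangular q (MvPolynomial.X 1))).totalDegree ≤ _
          rw [triangular_X_one, map_add, algEquiv_aeval]
          refine hq.trans ?_
          calc 1 + ((α (MvPolynomial.X 0)).totalDegree + 2) ^ 2 *
                  (α (MvPolynomial.X 0)).totalDegree ≤ 1 + (2 * D + 2) ^ 2 * (2 * D) := by
                gcongr
            _ ≤ (2 * D + 2) ^ 3 := by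
                have : (2 * D + 2) ^ 3 = (2 * D + 2) ^ 2 * (2 * D) + 2 * (2 * D + 2) ^ 2 := by ring
                have : 0 < (2 * D + 2) ^ 2 := by positivity
                omega
      have hdeg' : mapDegree (α'.symm : PlaneEnd K) ≤ 2 * ((2 * D + 2) ^ 3 + 2) ^ 2 :=
        (mapDegree_symm_le α').trans (by gcongr)
      have hgrow : 2 * ((2 * D + 2) ^ 3 + 2) ^ 2 ≤ degreeGrowth D :=
        Nat.le_mul_of_pos_left _ (by omega)
      have hψdeg : mapDegree ψ' ≤ degreeGrowth D := by
        have h1 : contractionX K * ψ' =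
            (α'.symm : PlaneEnd K) * ((α' : PlaneEnd K) * contractionX K * ψ') := by
          ext i
          simp
        have h2 : mapDegree ψ' ≤ mapDegree (contractionX K * ψ') :=
          max_le_max (totalDegree_le_contractionX _) (totalDegree_le_contractionX _)
        rw [h1, ← hφ] at h2
        refine h2.trans ((mapDegree_mul_le _ _).trans ?_)
        exact Nat.mul_le_mul (hD.trans (Nat.le_succ D)) hdeg'
      have hiter : degreeGrowth D ≤ degreeGrowth^[n + 1 + 1] D := by
        rw [Function.iterate_succ_apply]
        exact Function.id_le_iterate_of_id_le (fun x => le_degreeGrowth x) (n + 1) _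
      have hdegle : (2 * D + 2) ^ 3 ≤ 2 * ((2 * D + 2) ^ 3 + 2) ^ 2 := by
        nlinarith
      rw [hφ, ← partialContraction_one]
      refine BoundedProduct.mul α' 1 ((hdeg.trans (hdegle.trans hgrow)).trans hiter)
        ((hdeg'.trans hgrow).trans hiter) ?_
      exact ih (h.aut_mul _) _ hψdeg

/-- A bound for the degrees of the factors that suffices for all products of simple affine
contractions of degree at most `D`. -/
def factorBound (D : ℕ) : ℕ := degreeGrowth^[2 * D + 1] D + 1

/-- The number of factors is made independent of the product by means of trivial factors. -/
theorem IsProductOfSimpleAffineContractions.boundedProduct {K : Type*} [Field K] [CharZero K]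
    {φ : PlaneEnd K} (h : IsProductOfSimpleAffineContractions φ) {D : ℕ} (hD : mapDegree φ ≤ D) :
    BoundedProduct (factorBound D) (2 * D + 1) φ := by
  obtain ⟨n, hn⟩ := h.exists_hasContractions
  have hnD : n ≤ 2 * D := hn.le_two_mul_mapDegree.trans (Nat.mul_le_mul_left 2 hD)
  have h1 : BoundedProduct (factorBound D) (n + 1) φ := by
    refine (hn.boundedProduct D hD).mono ((?_ : _ ≤ degreeGrowth^[2 * D + 1] D).trans
      (Nat.le_succ _))
    exact Function.monotone_iterate_of_id_le (fun x => le_degreeGrowth x)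
      (Nat.succ_le_succ hnD) D
  have h2 : ∀ k, BoundedProduct (factorBound D) (n + 1 + k) φ := by
    intro k
    induction k with
    | zero => exact h1
    | succ k ih => exact ih.succ (Nat.le_add_left 1 _)
  have h3 := h2 (2 * D - n)
  rwa [show n + 1 + (2 * D - n) = 2 * D + 1 by omega] at h3

theorem isProduct_partialContraction {K : Type*} [Field K] (e : K) :
    IsProductOfSimpleAffineContractions (partialContraction e) := by
  by_cases he : e = 0
  · rw [he, partialContraction_zero]
    exact Submonoid.one_mem _
  -- `e * x + 1 - e = e * (x + l)`
  set l := (1 - e) / e with hl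
  have hel : e * l = 1 - e := mul_div_cancel₀ _ he
  let β : PlaneEnd K := MvPolynomial.aeval ![MvPolynomial.X 0 + MvPolynomial.C l, MvPolynomial.X 1]
  let γ : PlaneEnd K := MvPolynomial.aeval ![MvPolynomial.X 0 - MvPolynomial.C l,
    MvPolynomial.C e * MvPolynomial.X 1]
  have hβ : Function.Bijective β := by
    refine (AlgEquiv.ofAlgHom β
      (MvPolynomial.aeval ![MvPolynomial.X 0 - MvPolynomial.C l, MvPolynomial.X 1]) ?_ ?_).bijective
    · ext i
      fin_cases i <;> simp [β, MvPolynomial.algebraMap_eq]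
    · ext i
      fin_cases i <;> simp [β, MvPolynomial.algebraMap_eq]
  have hγ : Function.Bijective γ := by
    refine (AlgEquiv.ofAlgHom γ
      (MvPolynomial.aeval ![MvPolynomial.X 0 + MvPolynomial.C l,
        MvPolynomial.C e⁻¹ * MvPolynomial.X 1]) ?_ ?_).bijective
    · ext i
      fin_cases i
      · simp [γ, MvPolynomial.algebraMap_eq]
      · simp [γ, MvPolynomial.algebraMap_eq, ← mul_assoc, ← MvPolynomial.C_mul, he]
    · ext i
      fin_cases i
      · simp [γ, MvPolynomial.algebraMap_eq]
      · simp [γ, MvPolynomial.algebraMap_eq, ← mul_assoc, ← MvPolynomial.C_mul, he]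
  have hprod : partialContraction e = β * contractionX K * γ := by
    refine MvPolynomial.algHom_ext fun i => ?_
    fin_cases i
    · simp [partialContraction, β, γ, contractionX, MvPolynomial.algebraMap_eq]
    · simp [partialContraction, β, γ, contractionX, MvPolynomial.algebraMap_eq, ← hel]
      ring
  rw [hprod]
  exact Submonoid.mul_mem _ (Submonoid.mul_mem _ (Submonoid.subset_closure (Or.inl hβ))
    (Submonoid.subset_closure (Or.inr rfl))) (Submonoid.subset_closure (Or.inl hγ))

/-! ### The system of equations for a factorisation -/

/-- The operations that are used to write down a system of polynomial equations. No laws are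
required, so that symbolic expressions may carry such operations, too; `neg` stands for `-1`, and
`reg i` for the content of the register `i`. -/
structure Ops (R : Type*) where
  zero : R
  one : R
  neg : R
  add : R → R → R
  mul : R → R → R
  reg : ℕ → R

namespace Ops

variable {R : Type*} (o : Ops R)

/-- The difference, formed with the element `neg`. -/
def sub (a b : R) : R := o.add a (o.mul o.neg b)

/-- The sum of `n` copies of `one`. -/
def natCast (n : ℕ) : R := Nat.rec o.zero (fun _ r => o.add r o.one) n

/-- The `n`-th power, as an iterated product. -/
def pow (a : R) (n : ℕ) : R := Nat.rec o.one (fun _ r => o.mul r a) n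

/-- The value of a polynomial in one variable with coefficients `coef 0, ..., coef (n - 1)`, in
order of descending exponents. -/
def horner (n : ℕ) (coef : ℕ → R) (x : R) : R :=
  Nat.rec o.zero (fun i r => o.add (o.mul r x) (coef i)) n

/-- The value at `(x, y)` of the `q`-th unknown polynomial in two variables, of degree less than
`B` in each of them. Its coefficients are the unknowns `z (Nat.pair q (Nat.pair i j))`. -/
def unknownPoly (B : ℕ) (z : ℕ → R) (q : ℕ) (x y : R) : R :=
  o.horner B (fun i => o.horner B (fun j => z (Nat.pair q (Nat.pair i j))) y) x

/-- The value at `(x, y)` of a polynomial in sparse form. -/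
def sparse (p : SparsePoly) (x y : R) : R :=
  p.foldr (fun t r => o.add (o.mul (o.mul (o.reg t.2.2) (o.pow x t.1)) (o.pow y t.2.1)) r) o.zero

/-- The image of the point `(x, y)` after `k` factors. The `k`-th factor is the mapping with the
components `5 * k` and `5 * k + 1` among the unknown polynomials, followed by
`(x, y) ↦ (x, (e * x + 1 - e) * y)` for another unknown `e`. -/
def orbit (B : ℕ) (z : ℕ → R) (x y : R) (k : ℕ) : R × R :=
  Nat.rec (x, y) (fun k p =>
    (o.unknownPoly B z (5 * k) p.1 p.2,
      o.mul (o.add (o.mul (z (Nat.pair (5 * k + 4) 0)) (o.unknownPoly B z (5 * k) p.1 p.2))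
        (o.sub o.one (z (Nat.pair (5 * k + 4) 0)))) (o.unknownPoly B z (5 * k + 1) p.1 p.2))) k

/-- With `i = 2, 3`: the first and the second coordinate of the image of `(x, y)` under the
components of the `k`-th factor and its prospective inverse. -/
def inverseValue (B : ℕ) (z : ℕ → R) (x y : R) (i k : ℕ) : R :=
  o.unknownPoly B z (5 * k + i) (o.unknownPoly B z (5 * k) x y)
    (o.unknownPoly B z (5 * k + 1) x y)

/-- The errors in the inverses of the first `k` factors, as the coefficients of a polynomial
in `u`. -/
def inverseErrors (B : ℕ) (z : ℕ → R) (x y u : R) (k : ℕ) : R :=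
  Nat.rec o.zero (fun k r =>
    o.add (o.mul (o.add (o.mul r u) (o.sub (o.inverseValue B z x y 2 k) x)) u)
      (o.sub (o.inverseValue B z x y 3 k) y)) k

/-- All equations for a factorisation into `N` factors of the mapping given by `d`, as the
coefficients of a polynomial in `x, y, u`. -/
def system (d : SparsePoly × SparsePoly) (N B : ℕ) (z : ℕ → R) (x y u : R) : R :=
  o.add (o.mul (o.add (o.mul (o.inverseErrors B z x y u N) u)
    (o.sub (o.sparse d.1 x y) (o.orbit B z x y N).1)) u)
    (o.sub (o.sparse d.2 x y) (o.orbit B z x y N).2)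

/-- A mapping that is compatible with the operations. -/
structure IsHom {R S : Type*} (o : Ops R) (o' : Ops S) (f : R → S) : Prop where
  map_zero : f o.zero = o'.zero
  map_one : f o.one = o'.one
  map_neg : f o.neg = o'.neg
  map_add : ∀ a b, f (o.add a b) = o'.add (f a) (f b)
  map_mul : ∀ a b, f (o.mul a b) = o'.mul (f a) (f b)
  map_reg : ∀ i, f (o.reg i) = o'.reg i

namespace IsHom

variable {R S : Type*} {o : Ops R} {o' : Ops S} {f : R → S}

theorem map_sub (h : IsHom o o' f) (a b : R) : f (o.sub a b) = o'.sub (f a) (f b) := by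
  simp only [Ops.sub, h.map_add, h.map_mul, h.map_neg]

theorem map_natCast (h : IsHom o o' f) (n : ℕ) : f (o.natCast n) = o'.natCast n := by
  induction n with
  | zero => exact h.map_zero
  | succ n ih =>
    change f (o.add (o.natCast n) o.one) = o'.add (o'.natCast n) o'.one
    rw [h.map_add, ih, h.map_one]

theorem map_pow (h : IsHom o o' f) (a : R) (n : ℕ) : f (o.pow a n) = o'.pow (f a) n := by
  induction n with
  | zero => exact h.map_one
  | succ n ih =>
    change f (o.mul (o.pow a n) a) = o'.mul (o'.pow (f a) n) (f a)
    rw [h.map_mul, ih]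

theorem map_horner (h : IsHom o o' f) (n : ℕ) (coef : ℕ → R) (x : R) :
    f (o.horner n coef x) = o'.horner n (fun i => f (coef i)) (f x) := by
  induction n with
  | zero => exact h.map_zero
  | succ n ih =>
    change f (o.add (o.mul (o.horner n coef x) x) (coef n)) =
      o'.add (o'.mul (o'.horner n (fun i => f (coef i)) (f x)) (f x)) (f (coef n))
    rw [h.map_add, h.map_mul, ih]

theorem map_unknownPoly (h : IsHom o o' f) (B : ℕ) (z : ℕ → R) (q : ℕ) (x y : R) :
    f (o.unknownPoly B z q x y) = o'.unknownPoly B (fun i => f (z i)) q (f x) (f y) := by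
  simp only [Ops.unknownPoly, h.map_horner]

theorem map_sparse (h : IsHom o o' f) (p : SparsePoly) (x y : R) :
    f (o.sparse p x y) = o'.sparse p (f x) (f y) := by
  induction p with
  | nil => exact h.map_zero
  | cons t p ih =>
    simp only [Ops.sparse, List.foldr_cons] at ih ⊢
    rw [h.map_add, ih, h.map_mul, h.map_mul, h.map_pow, h.map_pow, h.map_reg]

theorem map_orbit (h : IsHom o o' f) (B : ℕ) (z : ℕ → R) (x y : R) (k : ℕ) :
    (f (o.orbit B z x y k).1, f (o.orbit B z x y k).2) =
      o'.orbit B (fun i => f (z i)) (f x) (f y) k := by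
  induction k with
  | zero => rfl
  | succ k ih =>
    simp only [Ops.orbit] at ih ⊢
    rw [← ih]
    simp only [h.map_mul, h.map_add, h.map_sub, h.map_one, h.map_unknownPoly]

theorem map_inverseValue (h : IsHom o o' f) (B : ℕ) (z : ℕ → R) (x y : R) (i k : ℕ) :
    f (o.inverseValue B z x y i k) = o'.inverseValue B (fun i => f (z i)) (f x) (f y) i k := by
  simp only [Ops.inverseValue, h.map_unknownPoly]

theorem map_inverseErrors (h : IsHom o o' f) (B : ℕ) (z : ℕ → R) (x y u : R) (k : ℕ) :
    f (o.inverseErrors B z x y u k) =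
      o'.inverseErrors B (fun i => f (z i)) (f x) (f y) (f u) k := by
  induction k with
  | zero => exact h.map_zero
  | succ k ih =>
    simp only [Ops.inverseErrors] at ih ⊢
    simp only [h.map_mul, h.map_add, h.map_sub, h.map_inverseValue, ih]

theorem map_system (h : IsHom o o' f) (d : SparsePoly × SparsePoly) (N B : ℕ) (z : ℕ → R)
    (x y u : R) :
    f (o.system d N B z x y u) = o'.system d N B (fun i => f (z i)) (f x) (f y) (f u) := by
  have h1 := congrArg Prod.fst (h.map_orbit B z x y N)
  have h2 := congrArg Prod.snd (h.map_orbit B z x y N)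
  simp only at h1 h2
  simp only [Ops.system, h.map_add, h.map_mul, h.map_sub, h.map_inverseErrors, h.map_sparse, h1, h2]

end IsHom

end Ops

/-- The operations of a commutative ring, with the register contents `c`. -/
def ringOps {R : Type*} [CommRing R] (c : ℕ → R) : Ops R where
  zero := 0
  one := 1
  neg := -1
  add := (· + ·)
  mul := (· * ·)
  reg := c

section RingOps

variable {R : Type*} [CommRing R] (c : ℕ → R)

theorem isHom_ringOps {S : Type*} [CommRing S] (f : R →+* S) :
    Ops.IsHom (ringOps c) (ringOps fun i => f (c i)) f where
  map_zero := f.map_zero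
  map_one := f.map_one
  map_neg := by simp [ringOps]
  map_add := f.map_add
  map_mul := f.map_mul
  map_reg _ := rfl

theorem ringOps_sub (a b : R) : (ringOps c).sub a b = a - b := by
  simp [Ops.sub, ringOps, sub_eq_add_neg]

theorem ringOps_natCast (n : ℕ) : (ringOps c).natCast n = n := by
  induction n with
  | zero => simp [Ops.natCast, ringOps]
  | succ n ih =>
    rw [Nat.cast_succ, ← ih]
    rfl

theorem ringOps_pow (a : R) (n : ℕ) : (ringOps c).pow a n = a ^ n := by
  induction n with
  | zero => simp [Ops.pow, ringOps]
  | succ n ih =>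
    rw [pow_succ, ← ih]
    rfl

theorem ringOps_horner (n : ℕ) (coef : ℕ → R) (x : R) :
    (ringOps c).horner n coef x = ∑ i ∈ Finset.range n, coef i * x ^ (n - 1 - i) := by
  induction n with
  | zero => simp [Ops.horner, ringOps]
  | succ n ih =>
    have h : (ringOps c).horner (n + 1) coef x = (ringOps c).horner n coef x * x + coef n := rfl
    rw [h, ih, Finset.sum_range_succ, Finset.sum_mul]
    simp only [Nat.add_sub_cancel, Nat.sub_self, pow_zero, mul_one]
    congr 1
    refine Finset.sum_congr rfl fun i hi => ?_
    rw [Finset.mem_range] at hi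
    rw [mul_assoc, ← pow_succ, show n - 1 - i + 1 = n - i by omega]

theorem ringOps_system (d : SparsePoly × SparsePoly) (N B : ℕ) (z : ℕ → R) (x y u : R) :
    (ringOps c).system d N B z x y u =
      ((ringOps c).inverseErrors B z x y u N * u +
        ((ringOps c).sparse d.1 x y - ((ringOps c).orbit B z x y N).1)) * u +
        ((ringOps c).sparse d.2 x y - ((ringOps c).orbit B z x y N).2) := by
  simp only [Ops.system, ringOps_sub]
  rfl

theorem ringOps_inverseErrors_succ (B : ℕ) (z : ℕ → R) (x y u : R) (k : ℕ) :
    (ringOps c).inverseErrors B z x y u (k + 1) =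
      ((ringOps c).inverseErrors B z x y u k * u +
        ((ringOps c).inverseValue B z x y 2 k - x)) * u +
        ((ringOps c).inverseValue B z x y 3 k - y) := by
  rw [← ringOps_sub c, ← ringOps_sub c]
  rfl

theorem ringOps_orbit_succ (B : ℕ) (z : ℕ → R) (x y : R) (k : ℕ) :
    (ringOps c).orbit B z x y (k + 1) =
      ((ringOps c).unknownPoly B z (5 * k) ((ringOps c).orbit B z x y k).1
          ((ringOps c).orbit B z x y k).2,
        (z (Nat.pair (5 * k + 4) 0) * (ringOps c).unknownPoly B z (5 * k)
          ((ringOps c).orbit B z x y k).1 ((ringOps c).orbit B z x y k).2 +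
            (1 - z (Nat.pair (5 * k + 4) 0))) *
          (ringOps c).unknownPoly B z (5 * k + 1) ((ringOps c).orbit B z x y k).1
            ((ringOps c).orbit B z x y k).2) := by
  rw [← ringOps_sub c]
  rfl

end RingOps

section PlaneSystem

variable {K : Type*} [Field K]

/-- The `q`-th unknown polynomial as an element of `K[x, y]`, for given values of the
unknowns. -/
noncomputable def unknownPlanePoly (B : ℕ) (z : ℕ → K) (q : ℕ) : PlaneRing K :=
  (ringOps (0 : ℕ → PlaneRing K)).unknownPoly B (fun i => MvPolynomial.C (z i)) q
    (MvPolynomial.X 0) (MvPolynomial.X 1)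

theorem ringOps_unknownPoly_congr {R : Type*} [CommRing R] (c c' : ℕ → R) (B : ℕ) (z : ℕ → R)
    (q : ℕ) (x y : R) :
    (ringOps c).unknownPoly B z q x y = (ringOps c').unknownPoly B z q x y := by
  simp only [Ops.unknownPoly, ringOps_horner]

theorem ringOps_unknownPoly_eq (c : ℕ → PlaneRing K) (B : ℕ) (z : ℕ → K) (q : ℕ)
    (φ : PlaneEnd K) :
    (ringOps c).unknownPoly B (fun i => MvPolynomial.C (z i)) q
      (φ (MvPolynomial.X 0)) (φ (MvPolynomial.X 1)) = φ (unknownPlanePoly B z q) := by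
  rw [unknownPlanePoly]
  have h := (isHom_ringOps (0 : ℕ → PlaneRing K) (φ : PlaneRing K →+* PlaneRing K)).map_unknownPoly
    B (fun i => MvPolynomial.C (z i)) q (MvPolynomial.X 0) (MvPolynomial.X 1)
  simp only [RingHom.coe_coe] at h
  rw [h, ringOps_unknownPoly_congr]
  congr 1
  funext i
  rw [← MvPolynomial.algebraMap_eq, φ.commutes]

theorem sum_range_monomial_eq {B : ℕ} {p : PlaneRing K} (hp : p.totalDegree < B) :
    ∑ a ∈ Finset.range B, ∑ b ∈ Finset.range B,
      MvPolynomial.monomial (Finsupp.single 0 a + Finsupp.single 1 b)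
        (p.coeff (Finsupp.single 0 a + Finsupp.single 1 b)) = p := by
  ext d
  have hd : d = Finsupp.single 0 (d 0) + Finsupp.single 1 (d 1) := by
    ext i
    fin_cases i <;> simp
  simp only [MvPolynomial.coeff_sum, MvPolynomial.coeff_monomial]
  by_cases h : d 0 < B ∧ d 1 < B
  · rw [Finset.sum_eq_single_of_mem (d 0) (Finset.mem_range.2 h.1),
      Finset.sum_eq_single_of_mem (d 1) (Finset.mem_range.2 h.2), if_pos hd.symm, ← hd]
    · intro b _ hb
      refine if_neg fun h' => hb ?_
      simpa using DFunLike.congr_fun h' 1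
    · intro a _ ha
      refine Finset.sum_eq_zero fun b _ => if_neg fun h' => ha ?_
      simpa using DFunLike.congr_fun h' 0
  · have h0 : p.coeff d = 0 := by
      by_contra hne
      have hle := MvPolynomial.le_totalDegree (MvPolynomial.mem_support_iff.2 hne)
      rw [Finsupp.sum_fintype _ _ (by simp), Fin.sum_univ_two] at hle
      omega
    rw [h0]
    refine Finset.sum_eq_zero fun a _ => Finset.sum_eq_zero fun b _ => ?_
    split_ifs with h'
    · rw [h', h0]
    · rfl

theorem unknownPlanePoly_eq {B : ℕ} {z : ℕ → K} {q : ℕ} {p : PlaneRing K}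
    (hp : p.totalDegree < B)
    (hz : ∀ i < B, ∀ j < B, z (Nat.pair q (Nat.pair i j)) =
      p.coeff (Finsupp.single 0 (B - 1 - i) + Finsupp.single 1 (B - 1 - j))) :
    unknownPlanePoly B z q = p := by
  rw [← sum_range_monomial_eq hp, ← Finset.sum_range_reflect, unknownPlanePoly, Ops.unknownPoly,
    ringOps_horner]
  refine Finset.sum_congr rfl fun i hi => ?_
  conv_rhs => rw [← Finset.sum_range_reflect]
  rw [ringOps_horner, Finset.sum_mul]
  refine Finset.sum_congr rfl fun j hj => ?_
  rw [hz i (Finset.mem_range.1 hi) j (Finset.mem_range.1 hj), MvPolynomial.monomial_eq,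
    Finsupp.prod_fintype _ _ (by simp), Fin.prod_univ_two]
  simp
  ring

/-- The polynomial mapping whose components are two consecutive unknown polynomials. -/
noncomputable def unknownMap (B : ℕ) (z : ℕ → K) (q : ℕ) : PlaneEnd K :=
  MvPolynomial.aeval ![unknownPlanePoly B z q, unknownPlanePoly B z (q + 1)]

/-- The product of the first `k` factors. -/
noncomputable def unknownProduct (B : ℕ) (z : ℕ → K) (k : ℕ) : PlaneEnd K :=
  ((List.range k).map fun i =>
    unknownMap B z (5 * i) * partialContraction (z (Nat.pair (5 * i + 4) 0))).prod

theorem ringOps_orbit_eq (c : ℕ → PlaneRing K) (B : ℕ) (z : ℕ → K) (k : ℕ) :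
    (ringOps c).orbit B (fun i => MvPolynomial.C (z i)) (MvPolynomial.X 0) (MvPolynomial.X 1) k =
      (unknownProduct B z k (MvPolynomial.X 0), unknownProduct B z k (MvPolynomial.X 1)) := by
  induction k with
  | zero => simp [Ops.orbit, unknownProduct]
  | succ k ih =>
    have hsucc : unknownProduct B z (k + 1) = unknownProduct B z k *
        (unknownMap B z (5 * k) * partialContraction (z (Nat.pair (5 * k + 4) 0))) := by
      simp [unknownProduct, List.range_succ]
    rw [ringOps_orbit_succ, ih, hsucc]
    simp only [ringOps_unknownPoly_eq]
    have hC : ∀ (ψ : PlaneEnd K) (a : K), ψ (MvPolynomial.C a) = MvPolynomial.C a := by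
      intro ψ a
      rw [← MvPolynomial.algebraMap_eq, ψ.commutes]
    simp [AlgHom.mul_apply, partialContraction, unknownMap, hC]

theorem ringOps_inverseValue_eq (c : ℕ → PlaneRing K) (B : ℕ) (z : ℕ → K) (i k : ℕ) :
    (ringOps c).inverseValue B (fun i => MvPolynomial.C (z i)) (MvPolynomial.X 0)
      (MvPolynomial.X 1) i k = unknownMap B z (5 * k) (unknownPlanePoly B z (5 * k + i)) := by
  have h0 : ∀ q, (ringOps c).unknownPoly B (fun i => MvPolynomial.C (z i)) q (MvPolynomial.X 0)
      (MvPolynomial.X 1) = unknownPlanePoly B z q := fun q =>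
    ringOps_unknownPoly_eq c B z q 1
  have h1 := ringOps_unknownPoly_eq c B z (5 * k + i) (unknownMap B z (5 * k))
  rw [Ops.inverseValue, h0, h0, ← h1]
  simp [unknownMap]

theorem ringOps_sparse_eq (c : ℕ → K) (p : SparsePoly) :
    (ringOps fun i => (MvPolynomial.C (c i) : PlaneRing K)).sparse p (MvPolynomial.X 0)
      (MvPolynomial.X 1) = SparsePoly.toPoly c p := by
  induction p with
  | nil => simp [Ops.sparse, SparsePoly.toPoly, ringOps]
  | cons t p ih =>
    have h : (ringOps fun i => (MvPolynomial.C (c i) : PlaneRing K)).sparse (t :: p)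
        (MvPolynomial.X 0) (MvPolynomial.X 1) =
        MvPolynomial.C (c t.2.2) *
          (ringOps fun i => (MvPolynomial.C (c i) : PlaneRing K)).pow (MvPolynomial.X 0) t.1 *
          (ringOps fun i => (MvPolynomial.C (c i) : PlaneRing K)).pow (MvPolynomial.X 1) t.2.1 +
        (ringOps fun i => (MvPolynomial.C (c i) : PlaneRing K)).sparse p (MvPolynomial.X 0)
          (MvPolynomial.X 1) := rfl
    rw [h, ih, ringOps_pow, ringOps_pow]
    simp [SparsePoly.toPoly]

theorem mul_X_add_C_mul_X_add_C_eq_zero {A : Type*} [CommRing A] {r : Polynomial A} {a b : A} :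
    (r * Polynomial.X + Polynomial.C a) * Polynomial.X + Polynomial.C b = 0 ↔
      r = 0 ∧ a = 0 ∧ b = 0 := by
  have key : ∀ (r : Polynomial A) (a : A),
      r * Polynomial.X + Polynomial.C a = 0 ↔ r = 0 ∧ a = 0 := by
    intro r a
    refine ⟨fun h => ?_, fun ⟨hr, ha⟩ => by simp [hr, ha]⟩
    have ha : a = 0 := by simpa using congrArg (fun p => Polynomial.coeff p 0) h
    refine ⟨?_, ha⟩
    ext n
    simpa [ha] using congrArg (fun p => Polynomial.coeff p (n + 1)) h
  rw [key, key, and_assoc]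

/-- The values `z` of the unknowns solve the system: it holds identically in the variables
`x, y, u`. -/
def IsSolution (d : SparsePoly × SparsePoly) (c : ℕ → K) (N B : ℕ) (z : ℕ → K) : Prop :=
  (ringOps fun i => (Polynomial.C (MvPolynomial.C (c i)) : Polynomial (PlaneRing K))).system d N B
    (fun i => Polynomial.C (MvPolynomial.C (z i))) (Polynomial.C (MvPolynomial.X 0))
    (Polynomial.C (MvPolynomial.X 1)) Polynomial.X = 0

/-- The meaning of the system: the unknown mappings with the numbers `5 * k` and `5 * k + 2` are
inverse to each other, and the given mapping is the product of the factors. -/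
theorem isSolution_iff {d : SparsePoly × SparsePoly} {c : ℕ → K} {φ : PlaneEnd K}
    (hd : Presents d c φ) (N B : ℕ) (z : ℕ → K) :
    IsSolution d c N B z ↔
      (∀ k < N, unknownMap B z (5 * k) * unknownMap B z (5 * k + 2) = 1) ∧
        φ = unknownProduct B z N := by
  have hC := isHom_ringOps (fun i => (MvPolynomial.C (c i) : PlaneRing K))
    (Polynomial.C : PlaneRing K →+* Polynomial (PlaneRing K))
  have hinv : ∀ i k, (ringOps fun i => (Polynomial.C (MvPolynomial.C (c i)) :
      Polynomial (PlaneRing K))).inverseValue B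
      (fun i => Polynomial.C (MvPolynomial.C (z i))) (Polynomial.C (MvPolynomial.X 0))
      (Polynomial.C (MvPolynomial.X 1)) i k =
      Polynomial.C (unknownMap B z (5 * k) (unknownPlanePoly B z (5 * k + i))) := by
    intro i k
    rw [← ringOps_inverseValue_eq (fun i => (MvPolynomial.C (c i) : PlaneRing K)),
      hC.map_inverseValue]
  have horb := hC.map_orbit B (fun i => MvPolynomial.C (z i)) (MvPolynomial.X 0)
    (MvPolynomial.X 1) N
  have herr : ∀ k, (ringOps fun i => (Polynomial.C (MvPolynomial.C (c i)) :
      Polynomial (PlaneRing K))).inverseErrors B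
      (fun i => Polynomial.C (MvPolynomial.C (z i))) (Polynomial.C (MvPolynomial.X 0))
      (Polynomial.C (MvPolynomial.X 1)) Polynomial.X k = 0 ↔
      ∀ i < k, unknownMap B z (5 * i) * unknownMap B z (5 * i + 2) = 1 := by
    intro k
    induction k with
    | zero => simp [Ops.inverseErrors, ringOps]
    | succ k ih =>
      rw [ringOps_inverseErrors_succ, hinv, hinv, ← Polynomial.C_sub, ← Polynomial.C_sub,
        mul_X_add_C_mul_X_add_C_eq_zero, ih, sub_eq_zero, sub_eq_zero, Nat.forall_lt_succ_right]
      refine and_congr_right fun _ => ⟨fun h => ?_, fun h => ?_⟩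
      · refine MvPolynomial.algHom_ext fun i => ?_
        fin_cases i
        · simpa [unknownMap] using h.1
        · simpa [unknownMap] using h.2
      · have h0 := DFunLike.congr_fun h (MvPolynomial.X 0)
        have h1 := DFunLike.congr_fun h (MvPolynomial.X 1)
        constructor
        · simpa [unknownMap] using h0
        · simpa [unknownMap] using h1
  rw [IsSolution, ringOps_system, ← horb, ← hC.map_sparse, ← hC.map_sparse, ringOps_sparse_eq,
    ringOps_sparse_eq, hd.1, hd.2, ringOps_orbit_eq, ← Polynomial.C_sub, ← Polynomial.C_sub,
    mul_X_add_C_mul_X_add_C_eq_zero, herr, sub_eq_zero, sub_eq_zero]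
  refine and_congr_right fun _ => ⟨fun h => ?_, fun h => by rw [h]; exact ⟨rfl, rfl⟩⟩
  refine MvPolynomial.algHom_ext fun i => ?_
  fin_cases i
  · exact h.1
  · exact h.2

/-- A right inverse suffices: a surjective endomorphism of a Noetherian ring is injective. -/
theorem bijective_of_mul_eq_one {α β : PlaneEnd K} (h : α * β = 1) : Function.Bijective α := by
  have hs : Function.Surjective α := fun p => ⟨β p, DFunLike.congr_fun h p⟩
  refine ⟨?_, hs⟩
  -- the kernels of the powers of `α` form an ascending chain of ideals
  have hmono : Monotone fun n : ℕ => RingHom.ker (α ^ n) := by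
    refine monotone_nat_of_le_succ fun n p hp => ?_
    rw [RingHom.mem_ker] at hp ⊢
    rw [pow_succ', AlgHom.mul_apply, hp, map_zero]
  obtain ⟨n, hn⟩ := monotone_stabilizes_iff_noetherian.2
    (inferInstance : IsNoetherian (PlaneRing K) (PlaneRing K)) ⟨_, hmono⟩
  have hsn : ∀ n : ℕ, Function.Surjective (α ^ n : PlaneEnd K) := by
    intro n
    induction n with
    | zero => exact fun p => ⟨p, rfl⟩
    | succ n ih =>
      rw [pow_succ]
      exact ih.comp hs
  rw [injective_iff_map_eq_zero]
  intro p hp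
  obtain ⟨q, rfl⟩ := hsn n p
  have hq : q ∈ RingHom.ker (α ^ (n + 1) : PlaneEnd K) := by
    rw [RingHom.mem_ker, pow_succ', AlgHom.mul_apply]
    exact hp
  have hker : RingHom.ker (α ^ n : PlaneEnd K) = RingHom.ker (α ^ (n + 1) : PlaneEnd K) :=
    hn (n + 1) n.le_succ
  rw [← hker, RingHom.mem_ker] at hq
  exact hq

/-- A solution of the system is a factorisation into simple affine contractions. -/
theorem IsSolution.isProduct {d : SparsePoly × SparsePoly} {c : ℕ → K} {φ : PlaneEnd K}
    (hd : Presents d c φ) {N B : ℕ} {z : ℕ → K} (h : IsSolution d c N B z) :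
    IsProductOfSimpleAffineContractions φ := by
  rw [isSolution_iff hd] at h
  rw [h.2]
  refine Submonoid.list_prod_mem _ fun ψ hψ => ?_
  obtain ⟨k, hk, rfl⟩ := List.mem_map.1 hψ
  exact Submonoid.mul_mem _ (Submonoid.subset_closure
    (Or.inl (bijective_of_mul_eq_one (h.1 k (List.mem_range.1 hk)))))
    (isProduct_partialContraction _)

/-- All unknowns that occur in the system for `N` factors of degree less than `B` have a number
below `unknownBound N B`. -/
def unknownBound (N B : ℕ) : ℕ := Nat.pair (5 * N) (Nat.pair B B)

theorem pair_lt_unknownBound {N B q i j : ℕ} (hq : q < 5 * N) (hi : i < B) (hj : j < B) :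
    Nat.pair q (Nat.pair i j) < unknownBound N B :=
  (Nat.pair_lt_pair_left _ hq).trans (Nat.pair_lt_pair_right _
    ((Nat.pair_lt_pair_left _ hi).trans (Nat.pair_lt_pair_right _ hj)))

theorem BoundedProduct.exists_sequences {B m : ℕ} {φ : PlaneEnd K} (h : BoundedProduct B m φ) :
    ∃ (α : ℕ → PlaneRing K ≃ₐ[K] PlaneRing K) (e : ℕ → K),
      (∀ k < m, mapDegree (α k : PlaneEnd K) ≤ B ∧ mapDegree ((α k).symm : PlaneEnd K) ≤ B) ∧
        φ = ((List.range m).map fun k => (α k : PlaneEnd K) * partialContraction (e k)).prod := by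
  induction h with
  | one => exact ⟨fun _ => AlgEquiv.refl, 0, by simp, by simp⟩
  | @mul α₀ e₀ m ψ h1 h2 h ih =>
    obtain ⟨α, e, hle, hprod⟩ := ih
    refine ⟨fun k => Nat.casesOn k α₀ α, fun k => Nat.casesOn k e₀ e, ?_, ?_⟩
    · intro k hk
      cases k with
      | zero => exact ⟨h1, h2⟩
      | succ k => exact hle k (by omega)
    · rw [List.range_succ_eq_map, List.map_cons, List.prod_cons, List.map_map, hprod]
      rfl

/-- A factorisation of bounded degree yields a solution of the system. -/
theorem BoundedProduct.exists_isSolution {d : SparsePoly × SparsePoly} {c : ℕ → K}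
    {φ : PlaneEnd K} (hd : Presents d c φ) {N B : ℕ} (h : BoundedProduct B N φ) :
    ∃ z : ℕ → K, (∀ i, unknownBound N (B + 1) ≤ i → z i = 0) ∧ IsSolution d c N (B + 1) z := by
  obtain ⟨α, e, hle, hprod⟩ := h.exists_sequences
  -- the polynomial with number `5 * k + i`
  let P : ℕ → ℕ → PlaneRing K := fun k i =>
    match i with
    | 0 => α k (MvPolynomial.X 0)
    | 1 => α k (MvPolynomial.X 1)
    | 2 => (α k).symm (MvPolynomial.X 0)
    | _ => (α k).symm (MvPolynomial.X 1)
  let z : ℕ → K := fun n =>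
    if n < unknownBound N (B + 1) then
      if n.unpair.1 % 5 = 4 then e (n.unpair.1 / 5)
      else (P (n.unpair.1 / 5) (n.unpair.1 % 5)).coeff
        (Finsupp.single 0 (B + 1 - 1 - n.unpair.2.unpair.1) +
          Finsupp.single 1 (B + 1 - 1 - n.unpair.2.unpair.2))
    else 0
  have hP : ∀ k < N, ∀ i < 4, unknownPlanePoly (B + 1) z (5 * k + i) = P k i := by
    intro k hk i hi
    have h1 := hle k hk
    simp only [mapDegree, max_le_iff] at h1
    refine unknownPlanePoly_eq ?_ fun a ha b hb => ?_
    · rw [Nat.lt_succ_iff]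
      interval_cases i
      · exact h1.1.1
      · exact h1.1.2
      · exact h1.2.1
      · exact h1.2.2
    · simp only [z]
      rw [if_pos (pair_lt_unknownBound (by omega) ha hb), Nat.unpair_pair, Nat.unpair_pair,
        if_neg (by dsimp only; omega)]
      dsimp only
      rw [show (5 * k + i) / 5 = k by omega, show (5 * k + i) % 5 = i by omega]
  have hz : ∀ k < N, z (Nat.pair (5 * k + 4) 0) = e k := by
    intro k hk
    simp only [z]
    have h0 : Nat.pair (5 * k + 4) 0 = Nat.pair (5 * k + 4) (Nat.pair 0 0) := by simp [Nat.pair]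
    rw [if_pos (h0 ▸ pair_lt_unknownBound (q := 5 * k + 4) (i := 0) (j := 0) (by omega) (by omega)
      (by omega)), Nat.unpair_pair,
      if_pos (by dsimp only; omega)]
    dsimp only
    rw [show (5 * k + 4) / 5 = k by omega]
  have hmap : ∀ k < N, unknownMap (B + 1) z (5 * k) = (α k : PlaneEnd K) := by
    intro k hk
    refine MvPolynomial.algHom_ext fun i => ?_
    fin_cases i
    · simpa [unknownMap, P] using hP k hk 0 (by omega)
    · simpa [unknownMap, P] using hP k hk 1 (by omega)
  have hmap' : ∀ k < N, unknownMap (B + 1) z (5 * k + 2) = ((α k).symm : PlaneEnd K) := by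
    intro k hk
    refine MvPolynomial.algHom_ext fun i => ?_
    fin_cases i
    · simpa [unknownMap, P] using hP k hk 2 (by omega)
    · simpa [unknownMap, P] using hP k hk 3 (by omega)
  refine ⟨z, fun i hi => if_neg (not_lt.2 hi), (isSolution_iff hd _ _ _).2 ⟨fun k hk => ?_, ?_⟩⟩
  · rw [hmap k hk, hmap' k hk]
    ext i
    simp
  · rw [hprod, unknownProduct]
    congr 1
    refine List.map_congr_left fun k hk => ?_
    rw [List.mem_range] at hk
    rw [hmap k hk, hz k hk]

theorem totalDegree_toPoly_le (c : ℕ → K) (p : SparsePoly) :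
    (SparsePoly.toPoly c p).totalDegree ≤ (p.map fun t => t.1 + t.2.1).sum := by
  induction p with
  | nil => simp [SparsePoly.toPoly]
  | cons t p ih =>
    simp only [SparsePoly.toPoly, List.map_cons, List.sum_cons] at ih ⊢
    refine (MvPolynomial.totalDegree_add _ _).trans (max_le ?_ (ih.trans (Nat.le_add_left _ _)))
    have h1 := MvPolynomial.totalDegree_mul
      (MvPolynomial.C (c t.2.2) * MvPolynomial.X 0 ^ t.1 : PlaneRing K) (MvPolynomial.X 1 ^ t.2.1)
    have h2 := MvPolynomial.totalDegree_mul (MvPolynomial.C (c t.2.2) : PlaneRing K)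
      (MvPolynomial.X 0 ^ t.1)
    rw [MvPolynomial.totalDegree_X_pow] at h1 h2
    rw [MvPolynomial.totalDegree_C] at h2
    omega

/-- A bound for the degree of the mapping with the sparse form `d`. -/
def sparseDegree (d : SparsePoly × SparsePoly) : ℕ :=
  (d.1.map fun t => t.1 + t.2.1).sum + (d.2.map fun t => t.1 + t.2.1).sum

theorem Presents.mapDegree_le {d : SparsePoly × SparsePoly} {c : ℕ → K} {φ : PlaneEnd K}
    (hd : Presents d c φ) : mapDegree φ ≤ sparseDegree d := by
  rw [mapDegree, ← hd.1, ← hd.2]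
  exact max_le ((totalDegree_toPoly_le c d.1).trans (Nat.le_add_right _ _))
    ((totalDegree_toPoly_le c d.2).trans (Nat.le_add_left _ _))

end PlaneSystem

/-! ### Symbolic polynomials -/

/-- A polynomial in variables that are numbered by `ℕ`, written as a list of terms. A term
consists of its monomial, as a list of variables with repetitions in any order, and of its
coefficient. -/
abbrev SymPoly : Type := List (List ℕ × ArithExpr)

namespace SymPoly

/-- The value of a symbolic polynomial when `v i` is substituted for the variable `i`. -/
noncomputable def eval {K : Type*} [Field K] {R : Type*} [CommRing R] [Algebra K R] (c : ℕ → K)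
    (v : ℕ → R) (P : SymPoly) : R :=
  (P.map fun t => algebraMap K R (t.2.eval c) * (t.1.map v).prod).sum

/-- A constant polynomial. -/
def const (e : ArithExpr) : SymPoly := [([], e)]

/-- A variable. -/
def var (i : ℕ) : SymPoly := [([i], .one)]

/-- The formal operations on symbolic polynomials. -/
def ops : Ops SymPoly where
  zero := []
  one := const .one
  neg := const (.sub .zero .one)
  add P Q := P ++ Q
  mul P Q := P.flatMap fun t => Q.map fun s => (t.1 ++ s.1, .mul t.2 s.2)
  reg i := const (.reg i)

section Eval

variable {K : Type*} [Field K] {R : Type*} [CommRing R] [Algebra K R] (c : ℕ → K) (v : ℕ → R)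

theorem eval_nil : eval c v [] = 0 := rfl

theorem eval_cons (t : List ℕ × ArithExpr) (P : SymPoly) :
    eval c v (t :: P) = algebraMap K R (t.2.eval c) * (t.1.map v).prod + eval c v P := by
  simp [eval]

theorem eval_append (P Q : SymPoly) : eval c v (P ++ Q) = eval c v P + eval c v Q := by
  simp [eval]

theorem eval_const (e : ArithExpr) : eval c v (const e) = algebraMap K R (e.eval c) := by
  simp [eval, const]

theorem eval_var (i : ℕ) : eval c v (var i) = v i := by
  simp [eval, var, ArithExpr.eval]

theorem eval_ops_mul (P Q : SymPoly) : eval c v (ops.mul P Q) = eval c v P * eval c v Q := by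
  have hterm : ∀ t : List ℕ × ArithExpr,
      eval c v (Q.map fun s => (t.1 ++ s.1, ArithExpr.mul t.2 s.2)) =
        algebraMap K R (t.2.eval c) * (t.1.map v).prod * eval c v Q := by
    intro t
    induction Q with
    | nil => simp [eval_nil]
    | cons s Q ih =>
      rw [List.map_cons, eval_cons, ih, eval_cons]
      simp only [ArithExpr.eval, List.map_append, List.prod_append, map_mul]
      ring
  induction P with
  | nil => simp [ops, eval_nil]
  | cons t P ih =>
    have h : ops.mul (t :: P) Q =
        (Q.map fun s => (t.1 ++ s.1, ArithExpr.mul t.2 s.2)) ++ ops.mul P Q := rfl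
    rw [h, eval_append, ih, hterm, eval_cons, add_mul]

theorem isHom_eval : Ops.IsHom ops (ringOps fun i => algebraMap K R (c i)) (eval c v) where
  map_zero := rfl
  map_one := by simp [ops, eval_const, ArithExpr.eval, ringOps]
  map_neg := by simp [ops, eval_const, ArithExpr.eval, ringOps]
  map_add := eval_append c v
  map_mul := eval_ops_mul c v
  map_reg i := by simp [ops, eval_const, ArithExpr.eval, ringOps]

theorem eval_eq_aeval (P : SymPoly) :
    eval c v P = MvPolynomial.aeval v (eval c (MvPolynomial.X : ℕ → MvPolynomial ℕ K) P) := by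
  induction P with
  | nil => simp [eval_nil]
  | cons t P ih =>
    rw [eval_cons, eval_cons, ih, map_add, map_mul, map_list_prod, List.map_map,
      AlgHom.commutes]
    congr 3
    exact List.map_congr_left fun i _ => by simp

end Eval

/-- The coefficient of the monomial `l`, as an arithmetic expression. -/
def coeffExpr (P : SymPoly) (l : List ℕ) : ArithExpr :=
  P.foldr (fun t r => if t.1.Perm l then .add t.2 r else r) .zero

/-- An expression with the value `1` if `e` has the value `0`, and with the value `0` otherwise,
since `e / e = 0` for `e = 0`. -/
def isZeroExpr (e : ArithExpr) : ArithExpr := .sub .one (.div e e)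

/-- An expression that has the value `1` if and only if `P` is the zero polynomial. -/
def zeroTest (P : SymPoly) : ArithExpr :=
  P.foldr (fun t r => .mul (isZeroExpr (coeffExpr P t.1)) r) .one

variable {K : Type*} [Field K] (c : ℕ → K)

theorem coeff_eval (P : SymPoly) (l : List ℕ) :
    (eval c (MvPolynomial.X : ℕ → MvPolynomial ℕ K) P).coeff
      (Multiset.toFinsupp (l : Multiset ℕ)) = (coeffExpr P l).eval c := by
  have hmon : ∀ l : List ℕ, (l.map (MvPolynomial.X : ℕ → MvPolynomial ℕ K)).prod =
      MvPolynomial.monomial (Multiset.toFinsupp (l : Multiset ℕ)) 1 := by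
    intro l
    induction l with
    | nil => simp
    | cons i l ih =>
      rw [List.map_cons, List.prod_cons, ih, MvPolynomial.X, MvPolynomial.monomial_mul, one_mul,
        ← Multiset.cons_coe, ← Multiset.singleton_add, Multiset.toFinsupp_add,
        Multiset.toFinsupp_singleton]
  induction P with
  | nil => simp [eval_nil, coeffExpr, ArithExpr.eval]
  | cons t P ih =>
    rw [eval_cons, MvPolynomial.coeff_add, ih, hmon, MvPolynomial.algebraMap_eq,
      MvPolynomial.C_mul_monomial, mul_one, MvPolynomial.coeff_monomial]
    have hperm : Multiset.toFinsupp (t.1 : Multiset ℕ) = Multiset.toFinsupp (l : Multiset ℕ) ↔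
        t.1.Perm l := by
      rw [EmbeddingLike.apply_eq_iff_eq, Multiset.coe_eq_coe]
    simp only [hperm, coeffExpr, List.foldr_cons]
    split_ifs
    · rfl
    · rw [zero_add]

theorem eval_isZeroExpr (e : ArithExpr) [Decidable (e.eval c = 0)] :
    (isZeroExpr e).eval c = if e.eval c = 0 then 1 else 0 := by
  split_ifs with h
  · simp [isZeroExpr, ArithExpr.eval, h]
  · simp [isZeroExpr, ArithExpr.eval, h]

theorem eval_zeroTest (P : SymPoly) :
    (zeroTest P).eval c = 1 ↔ eval c (MvPolynomial.X : ℕ → MvPolynomial ℕ K) P = 0 := by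
  classical
  have hfold : ∀ Q : SymPoly,
      (Q.foldr (fun t r => ArithExpr.mul (isZeroExpr (coeffExpr P t.1)) r) .one).eval c = 1 ↔
        ∀ t ∈ Q, (coeffExpr P t.1).eval c = 0 := by
    intro Q
    induction Q with
    | nil => simp [ArithExpr.eval]
    | cons t Q ih =>
      rw [List.foldr_cons, ArithExpr.eval, eval_isZeroExpr, List.forall_mem_cons, ← ih]
      split_ifs with h
      · simp [h]
      · simp [h]
  rw [zeroTest, hfold]
  refine ⟨fun h => ?_, fun h t _ => by rw [← coeff_eval, h, MvPolynomial.coeff_zero]⟩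
  ext m
  rw [MvPolynomial.coeff_zero]
  obtain ⟨l, rfl⟩ : ∃ l : List ℕ, m = Multiset.toFinsupp (l : Multiset ℕ) :=
    ⟨(Finsupp.toMultiset m).toList, by simp⟩
  rw [coeff_eval]
  by_cases hl : ∃ t ∈ P, t.1.Perm l
  · obtain ⟨t, ht, hperm⟩ := hl
    have h1 := h t ht
    rwa [← coeff_eval, Multiset.coe_eq_coe.2 hperm, coeff_eval] at h1
  · have hnone : ∀ Q : SymPoly, (∀ t ∈ Q, ¬ t.1.Perm l) → coeffExpr Q l = .zero := by
      intro Q hQ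
      induction Q with
      | nil => rfl
      | cons t Q ih =>
        rw [List.forall_mem_cons] at hQ
        simp only [coeffExpr, List.foldr_cons] at ih ⊢
        rw [if_neg hQ.1, ih hQ.2]
    rw [hnone P fun t ht hp => hl ⟨t, ht, hp⟩]
    rfl

/-- The polynomial in the variable `3` with the coefficients `l`, in order of ascending
exponents. -/
def ofCoeffs (l : List ArithExpr) : SymPoly :=
  l.foldr (fun a r => ops.add (const a) (ops.mul (var 3) r)) ops.zero

/-- The monic polynomial in the variable `3` of degree `l.length` with the lower coefficients
`l`. -/
def monicOfCoeffs (l : List ArithExpr) : SymPoly :=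
  l.foldr (fun a r => ops.add (const a) (ops.mul (var 3) r)) ops.one

theorem eval_ofCoeffs {R : Type*} [CommRing R] [Algebra K R] (v : ℕ → R) (l : List ArithExpr) :
    eval c v (ofCoeffs l) = Polynomial.aeval (v 3) (∑ i ∈ Finset.range l.length,
      Polynomial.C ((l.getD i .zero).eval c) * Polynomial.X ^ i) := by
  induction l with
  | nil => simp [ofCoeffs, ops, eval_nil]
  | cons a l ih =>
    have h : ofCoeffs (a :: l) = ops.add (const a) (ops.mul (var 3) (ofCoeffs l)) := rfl
    rw [h, show ops.add (const a) (ops.mul (var 3) (ofCoeffs l)) =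
      const a ++ ops.mul (var 3) (ofCoeffs l) from rfl, eval_append, eval_ops_mul, eval_const,
      eval_var, ih, List.length_cons, Finset.sum_range_succ']
    simp only [List.getD_cons_succ, List.getD_cons_zero, map_add, map_sum, map_mul,
      Polynomial.aeval_C, map_pow, Polynomial.aeval_X, Finset.mul_sum, pow_zero, mul_one]
    rw [add_comm]
    congr 1
    exact Finset.sum_congr rfl fun i _ => by ring

theorem eval_monicOfCoeffs {R : Type*} [CommRing R] [Algebra K R] (v : ℕ → R)
    (l : List ArithExpr) :
    eval c v (monicOfCoeffs l) = Polynomial.aeval (v 3) (Polynomial.X ^ l.length +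
      ∑ i ∈ Finset.range l.length,
        Polynomial.C ((l.getD i .zero).eval c) * Polynomial.X ^ i) := by
  induction l with
  | nil =>
    simp [monicOfCoeffs, ops, eval_const, ArithExpr.eval]
  | cons a l ih =>
    have h : monicOfCoeffs (a :: l) = const a ++ ops.mul (var 3) (monicOfCoeffs l) := rfl
    rw [h, eval_append, eval_ops_mul, eval_const,
      eval_var, ih, List.length_cons, Finset.sum_range_succ']
    simp only [List.getD_cons_succ, List.getD_cons_zero, map_add, map_sum, map_mul,
      Polynomial.aeval_C, map_pow, Polynomial.aeval_X, Finset.mul_sum, pow_zero, mul_one, mul_add]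
    rw [add_comm, add_assoc]
    congr 1
    · ring
    · congr 1
      exact Finset.sum_congr rfl fun i _ => by ring

end SymPoly

/-! ### Certificates -/

/-- A certificate for a solution of the system. The first two components are the lower
coefficients of a monic polynomial `m` of positive degree in a variable `T`, the third one lists
values of the unknowns that are polynomials in `T`, and the last one is a quotient of the system
by `m`. -/
abbrev SolutionCert : Type := ArithExpr × List ArithExpr × List (List ArithExpr) × SymPoly

/-- A certificate for the absence of solutions: a linear combination of values of the system at
points `(x, y, u)` with natural coordinates, with symbolic polynomials in the unknowns as
coefficients. -/
abbrev NoSolutionCert : Type := List ((ℕ × ℕ × ℕ) × SymPoly)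

/-- The number of factors in the system. -/
def factorNumber (d : SparsePoly × SparsePoly) : ℕ := 2 * sparseDegree d + 1

/-- The strict bound for the degrees of the unknown polynomials in the system. -/
def factorDegree (d : SparsePoly × SparsePoly) : ℕ := factorBound (sparseDegree d) + 1

/-- The system in symbolic polynomials, with a list of values of the unknowns. -/
def symSystem (d : SparsePoly × SparsePoly) (z : List SymPoly) (x y u : SymPoly) : SymPoly :=
  SymPoly.ops.system d (factorNumber d) (factorDegree d) (fun i => z.getD i []) x y u

/-- The polynomial in the variables `0, 1, 2, 3`, standing for `x, y, u, T`, that vanishes for a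
valid certificate. -/
def SolutionCert.poly (d : SparsePoly × SparsePoly) (C : SolutionCert) : SymPoly :=
  SymPoly.ops.sub
    (symSystem d (C.2.2.1.map SymPoly.ofCoeffs) (SymPoly.var 0) (SymPoly.var 1) (SymPoly.var 2))
    (SymPoly.ops.mul (SymPoly.monicOfCoeffs (C.1 :: C.2.1)) C.2.2.2)

/-- The polynomial in the unknowns that vanishes for a valid certificate: the linear combination,
minus `1`. -/
def NoSolutionCert.poly (d : SparsePoly × SparsePoly) (C : NoSolutionCert) : SymPoly :=
  C.foldr (fun t r => SymPoly.ops.add (SymPoly.ops.mul t.2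
    (symSystem d ((List.range (unknownBound (factorNumber d) (factorDegree d))).map SymPoly.var)
      (SymPoly.ops.natCast t.1.1) (SymPoly.ops.natCast t.1.2.1) (SymPoly.ops.natCast t.1.2.2))) r)
    SymPoly.ops.neg

section Soundness

variable {K : Type*} [Field K] {c : ℕ → K} {d : SparsePoly × SparsePoly}

theorem eval_symSystem {R : Type*} [CommRing R] [Algebra K R] (c : ℕ → K) (v : ℕ → R)
    (d : SparsePoly × SparsePoly) (z : List SymPoly) (x y u : SymPoly) :
    (symSystem d z x y u).eval c v = (ringOps fun i => algebraMap K R (c i)).system d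
      (factorNumber d) (factorDegree d) (fun i => (z.getD i []).eval c v)
      (x.eval c v) (y.eval c v) (u.eval c v) :=
  (SymPoly.isHom_eval c v).map_system _ _ _ _ _ _ _

theorem eval_solutionCert_poly {R : Type*} [CommRing R] [Algebra K R] (c : ℕ → K) (v : ℕ → R)
    (d : SparsePoly × SparsePoly) (C : SolutionCert) :
    (C.poly d).eval c v = (ringOps fun i => algebraMap K R (c i)).system d (factorNumber d)
      (factorDegree d) (fun i => ((C.2.2.1.map SymPoly.ofCoeffs).getD i []).eval c v)
      (v 0) (v 1) (v 2) -
      (SymPoly.monicOfCoeffs (C.1 :: C.2.1)).eval c v * C.2.2.2.eval c v := by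
  rw [SolutionCert.poly, (SymPoly.isHom_eval c v).map_sub, ringOps_sub, eval_symSystem,
    SymPoly.eval_ops_mul, SymPoly.eval_var, SymPoly.eval_var, SymPoly.eval_var]

theorem eval_noSolutionCert_poly {R : Type*} [CommRing R] [Algebra K R] (c : ℕ → K) (v : ℕ → R)
    (d : SparsePoly × SparsePoly) (C : NoSolutionCert) :
    (C.poly d).eval c v = (C.map fun t => t.2.eval c v *
      (ringOps fun i => algebraMap K R (c i)).system d (factorNumber d) (factorDegree d)
        (fun i => if i < unknownBound (factorNumber d) (factorDegree d) then v i else 0)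
        t.1.1 t.1.2.1 t.1.2.2).sum - 1 := by
  have hvar : (fun i => (((List.range (unknownBound (factorNumber d) (factorDegree d))).map
      SymPoly.var).getD i []).eval c v) =
      fun i => if i < unknownBound (factorNumber d) (factorDegree d) then v i else 0 := by
    funext i
    split_ifs with hi
    · rw [List.getD_eq_getElem _ _ (by simpa using hi)]
      simp [SymPoly.eval_var]
    · rw [List.getD_eq_default _ _ (by simpa using hi), SymPoly.eval_nil]
  have h := SymPoly.isHom_eval (R := R) c v
  induction C with
  | nil =>
    simp only [NoSolutionCert.poly, List.foldr_nil, h.map_neg]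
    simp [ringOps]
  | cons t C ih =>
    have hcons : NoSolutionCert.poly d (t :: C) = SymPoly.ops.mul t.2
        (symSystem d ((List.range (unknownBound (factorNumber d) (factorDegree d))).map
          SymPoly.var) (SymPoly.ops.natCast t.1.1) (SymPoly.ops.natCast t.1.2.1)
          (SymPoly.ops.natCast t.1.2.2)) ++ NoSolutionCert.poly d C := rfl
    rw [hcons, SymPoly.eval_append, SymPoly.eval_ops_mul, ih, eval_symSystem, hvar,
      h.map_natCast, h.map_natCast, h.map_natCast, ringOps_natCast, ringOps_natCast,
      ringOps_natCast, List.map_cons, List.sum_cons]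
    ring

/-- A root in `K` of the monic polynomial of the certificate turns it into a solution. -/
theorem SolutionCert.exists_isSolution [IsAlgClosed K] {C : SolutionCert}
    (h : (SymPoly.zeroTest (C.poly d)).eval c = 1) :
    ∃ z, IsSolution d c (factorNumber d) (factorDegree d) z := by
  rw [SymPoly.eval_zeroTest] at h
  -- the polynomial `m` has a root in `K`
  set l := C.1 :: C.2.1 with hl
  set low : Polynomial K := ∑ i ∈ Finset.range l.length,
    Polynomial.C ((l.getD i .zero).eval c) * Polynomial.X ^ i with hlow
  have hdeg : low.degree < l.length := by
    refine Polynomial.degree_lt_iff_coeff_zero _ _ |>.2 fun n hn => ?_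
    rw [hlow, Polynomial.finsetSum_coeff]
    refine Finset.sum_eq_zero fun i hi => ?_
    rw [Polynomial.coeff_C_mul_X_pow, if_neg]
    have := Finset.mem_range.1 hi
    omega
  have hm : (Polynomial.X ^ l.length + low).degree ≠ 0 := by
    rw [Polynomial.degree_add_eq_left_of_degree_lt (by rwa [Polynomial.degree_X_pow]),
      Polynomial.degree_X_pow, hl]
    simp only [List.length_cons]
    norm_cast
  obtain ⟨θ, hθ⟩ := IsAlgClosed.exists_root _ hm
  let v : ℕ → Polynomial (PlaneRing K) := fun i =>
    match i with
    | 0 => Polynomial.C (MvPolynomial.X 0)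
    | 1 => Polynomial.C (MvPolynomial.X 1)
    | 2 => Polynomial.X
    | _ => Polynomial.C (MvPolynomial.C θ)
  have hv := SymPoly.eval_eq_aeval c v (C.poly d)
  have halg : ∀ a : K, algebraMap K (Polynomial (PlaneRing K)) a =
      Polynomial.C (MvPolynomial.C a) := fun _ => rfl
  have hv3 : v 3 = algebraMap K _ θ := rfl
  rw [h, map_zero, eval_solutionCert_poly, ← hl, SymPoly.eval_monicOfCoeffs, ← hlow, hv3,
    Polynomial.aeval_algebraMap_apply, Polynomial.coe_aeval_eq_eval, hθ.eq_zero, map_zero,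
    zero_mul, sub_zero] at hv
  refine ⟨fun i => ((C.2.2.1.map SymPoly.ofCoeffs).getD i []).eval c fun _ => θ, ?_⟩
  have hz : (fun i => Polynomial.C (MvPolynomial.C
      (((C.2.2.1.map SymPoly.ofCoeffs).getD i []).eval c fun _ => θ))) =
      fun i => ((C.2.2.1.map SymPoly.ofCoeffs).getD i []).eval c v := ?_
  · rw [IsSolution, hz]
    exact hv
  funext i
  by_cases hi : i < C.2.2.1.length
  · rw [List.getD_eq_getElem _ _ (by simpa using hi), List.getElem_map, SymPoly.eval_ofCoeffs,
      SymPoly.eval_ofCoeffs, hv3, Polynomial.aeval_algebraMap_apply, halg]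
  · rw [List.getD_eq_default _ _ (by simpa using hi), SymPoly.eval_nil, SymPoly.eval_nil]
    simp

/-- At a solution, all values of the system vanish, so that the linear combination cannot be
`1`. -/
theorem NoSolutionCert.false {C : NoSolutionCert}
    (h : (SymPoly.zeroTest (C.poly d)).eval c = 1) {z : ℕ → K}
    (hz : ∀ i, unknownBound (factorNumber d) (factorDegree d) ≤ i → z i = 0)
    (hsol : IsSolution d c (factorNumber d) (factorDegree d) z) : False := by
  rw [SymPoly.eval_zeroTest] at h
  have hv := SymPoly.eval_eq_aeval c z (C.poly d)
  rw [h, map_zero, eval_noSolutionCert_poly] at hv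
  have hz' : (fun i => if i < unknownBound (factorNumber d) (factorDegree d) then z i else 0) =
      z := by
    funext i
    split_ifs with hi
    · rfl
    · exact (hz i (not_lt.1 hi)).symm
  have hzero : ∀ a b e : ℕ, (ringOps fun i => algebraMap K K (c i)).system d (factorNumber d)
      (factorDegree d) z (a : K) (b : K) (e : K) = 0 := by
    intro a b e
    let f : Polynomial (PlaneRing K) →+* K := Polynomial.eval₂RingHom
      (MvPolynomial.aeval ![(a : K), (b : K)] : PlaneRing K →ₐ[K] K).toRingHom (e : K)
    have hf := (isHom_ringOps (fun i => (Polynomial.C (MvPolynomial.C (c i)) :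
      Polynomial (PlaneRing K))) f).map_system d (factorNumber d) (factorDegree d)
      (fun i => Polynomial.C (MvPolynomial.C (z i))) (Polynomial.C (MvPolynomial.X 0))
      (Polynomial.C (MvPolynomial.X 1)) Polynomial.X
    rw [IsSolution] at hsol
    rw [hsol, map_zero] at hf
    simpa [f] using hf.symm
  rw [hz'] at hv
  simp only [hzero, mul_zero, List.map_const', List.sum_replicate, smul_zero, zero_sub] at hv
  exact one_ne_zero (neg_eq_zero.1 hv)

end Soundness

/-! ### Existence of certificates -/

/-- The field that is generated by the register contents: the values of all arithmetic
expressions. -/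
def valueField {K : Type*} [Field K] (c : ℕ → K) : Subfield K where
  carrier := Set.range fun e : ArithExpr => e.eval c
  zero_mem' := ⟨.zero, rfl⟩
  one_mem' := ⟨.one, rfl⟩
  add_mem' := by
    rintro _ _ ⟨a, rfl⟩ ⟨b, rfl⟩
    exact ⟨.add a b, rfl⟩
  mul_mem' := by
    rintro _ _ ⟨a, rfl⟩ ⟨b, rfl⟩
    exact ⟨.mul a b, rfl⟩
  neg_mem' := by
    rintro _ ⟨a, rfl⟩
    exact ⟨.sub .zero a, zero_sub _⟩
  inv_mem' := by
    rintro _ ⟨a, rfl⟩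
    exact ⟨.div .one a, one_div _⟩

section Completeness

variable {K : Type*} [Field K] (c : ℕ → K)

/-- The polynomials that can be written down as symbolic polynomials. -/
def symbolicSubring : Subring (MvPolynomial ℕ K) where
  carrier := Set.range fun P : SymPoly => P.eval c MvPolynomial.X
  zero_mem' := ⟨[], SymPoly.eval_nil c _⟩
  one_mem' := ⟨SymPoly.const .one, by simp [SymPoly.eval_const, ArithExpr.eval]⟩
  add_mem' := by
    rintro _ _ ⟨P, rfl⟩ ⟨Q, rfl⟩
    exact ⟨P ++ Q, SymPoly.eval_append c _ P Q⟩
  mul_mem' := by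
    rintro _ _ ⟨P, rfl⟩ ⟨Q, rfl⟩
    exact ⟨SymPoly.ops.mul P Q, SymPoly.eval_ops_mul c _ P Q⟩
  neg_mem' := by
    rintro _ ⟨P, rfl⟩
    refine ⟨SymPoly.ops.mul (SymPoly.const (.sub .zero .one)) P, ?_⟩
    simp [SymPoly.eval_ops_mul, SymPoly.eval_const, ArithExpr.eval]

theorem X_mem_symbolicSubring (i : ℕ) : MvPolynomial.X i ∈ symbolicSubring c :=
  ⟨SymPoly.var i, SymPoly.eval_var c _ i⟩

theorem C_mem_symbolicSubring (a : valueField c) : MvPolynomial.C (a : K) ∈ symbolicSubring c := by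
  obtain ⟨e, he⟩ := a.2
  refine ⟨SymPoly.const e, ?_⟩
  dsimp only at he ⊢
  rw [SymPoly.eval_const, he, MvPolynomial.algebraMap_eq]

/-- If the values of the system at all points with natural coordinates generate the unit ideal in
the polynomial ring of the unknowns over the field of values, then there is a certificate for the
absence of solutions. -/
theorem exists_noSolutionCert (d : SparsePoly × SparsePoly)
    (h : Ideal.span (Set.range fun p : ℕ × ℕ × ℕ =>
      (ringOps fun i => (MvPolynomial.C ⟨c i, .reg i, rfl⟩ : MvPolynomial
        (Fin (unknownBound (factorNumber d) (factorDegree d))) (valueField c))).system d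
        (factorNumber d) (factorDegree d)
        (fun i => if hi : i < unknownBound (factorNumber d) (factorDegree d) then
          MvPolynomial.X ⟨i, hi⟩ else 0) p.1 p.2.1 p.2.2) = ⊤) :
    ∃ C : NoSolutionCert, (SymPoly.zeroTest (C.poly d)).eval c = 1 := by
  set M := unknownBound (factorNumber d) (factorDegree d) with hM
  let θ : MvPolynomial (Fin M) (valueField c) →+* MvPolynomial ℕ K :=
    MvPolynomial.eval₂Hom ((MvPolynomial.C : K →+* MvPolynomial ℕ K).comp (valueField c).subtype)
      fun i => MvPolynomial.X (i : ℕ)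
  have hθ : ∀ q, θ q ∈ symbolicSubring c := by
    intro q
    induction q using MvPolynomial.induction_on with
    | C a =>
      simp only [θ, MvPolynomial.eval₂Hom_C]
      exact C_mem_symbolicSubring c a
    | add p q hp hq =>
      rw [map_add]
      exact add_mem hp hq
    | mul_X p i hp =>
      rw [map_mul]
      refine mul_mem hp ?_
      simp only [θ, MvPolynomial.eval₂Hom_X']
      exact X_mem_symbolicSubring c i
  choose rep hrep using hθ
  obtain ⟨q, hq⟩ := Finsupp.mem_ideal_span_range_iff_exists_finsupp.1
    ((Ideal.eq_top_iff_one _).1 h)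
  refine ⟨q.support.toList.map fun p => (p, rep (q p)), ?_⟩
  rw [SymPoly.eval_zeroTest, eval_noSolutionCert_poly, List.map_map, sub_eq_zero]
  have hθq := congrArg θ hq
  rw [map_one, Finsupp.sum, map_sum] at hθq
  rw [← hθq, ← Finset.sum_map_toList]
  congr 1
  refine List.map_congr_left fun p _ => ?_
  have hsys := (isHom_ringOps (fun i => (MvPolynomial.C ⟨c i, .reg i, rfl⟩ : MvPolynomial
    (Fin M) (valueField c))) θ).map_system d (factorNumber d) (factorDegree d)
    (fun i => if hi : i < M then MvPolynomial.X ⟨i, hi⟩ else 0) p.1 p.2.1 p.2.2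
  have hrep' := hrep (q p)
  dsimp only at hrep'
  rw [map_mul, hsys, ← hrep']
  have hz : (fun i => θ (if hi : i < M then MvPolynomial.X ⟨i, hi⟩ else 0)) =
      fun i => if i < M then MvPolynomial.X i else 0 := by
    funext i
    split_ifs with hi
    · simp [θ]
    · exact map_zero θ
  have hc : (fun i => θ (MvPolynomial.C ⟨c i, .reg i, rfl⟩)) =
      fun i => algebraMap K (MvPolynomial ℕ K) (c i) := by
    funext i
    simp [θ, MvPolynomial.algebraMap_eq]
  rw [hz, hc]
  simp only [Function.comp_apply, map_natCast]
  rfl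

/-- If the system has a solution in a finite extension of the field of values, then there is a
certificate for it. -/
theorem exists_solutionCert [CharZero K] (d : SparsePoly × SparsePoly) {L : Type*} [Field L]
    [Algebra (valueField c) L] [Module.Finite (valueField c) L] (z : ℕ → L) {M : ℕ}
    (hzM : ∀ i, M ≤ i → z i = 0)
    (h : ∀ a b e : ℕ, (ringOps fun i => algebraMap (valueField c) L ⟨c i, .reg i, rfl⟩).system d
      (factorNumber d) (factorDegree d) z a b e = 0) :
    ∃ C : SolutionCert, (SymPoly.zeroTest (C.poly d)).eval c = 1 := by
  have hchar : CharZero L := charZero_of_injective_algebraMap (algebraMap (valueField c) L).injective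
  -- the system vanishes identically
  have hvanish : (ringOps fun i => (MvPolynomial.C (algebraMap (valueField c) L ⟨c i, .reg i, rfl⟩) :
      MvPolynomial (Fin 3) L)).system d (factorNumber d) (factorDegree d)
      (fun i => MvPolynomial.C (z i)) (MvPolynomial.X 0) (MvPolynomial.X 1) (MvPolynomial.X 2) =
      0 := by
    refine MvPolynomial.funext_set (fun _ => Set.range ((↑) : ℕ → L))
      (fun _ => Set.infinite_range_of_injective Nat.cast_injective) fun p hp => ?_
    have hp' : ∀ i, ∃ n : ℕ, (n : L) = p i := fun i => hp i trivial
    choose n hn using hp'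
    have := (isHom_ringOps (fun i => (MvPolynomial.C (algebraMap (valueField c) L
      ⟨c i, .reg i, rfl⟩) : MvPolynomial (Fin 3) L)) (MvPolynomial.eval p)).map_system d
      (factorNumber d) (factorDegree d) (fun i => MvPolynomial.C (z i)) (MvPolynomial.X 0)
      (MvPolynomial.X 1) (MvPolynomial.X 2)
    rw [this, map_zero]
    simp only [MvPolynomial.eval_C, MvPolynomial.eval_X, ← hn]
    exact h _ _ _
  -- the unknowns as polynomials in a primitive element
  let pb := Field.powerBasisOfFiniteOfSeparable (valueField c) L
  have hrepz : ∀ i, ∃ f : Polynomial (valueField c), Polynomial.aeval pb.gen f = z i :=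
    fun i => (pb.exists_eq_aeval' (z i)).imp fun _ hf => hf.symm
  choose f₀ hf₀ using hrepz
  let f : ℕ → Polynomial (valueField c) := fun i => if i < M then f₀ i else 0
  have hf : ∀ i, Polynomial.aeval pb.gen (f i) = z i := by
    intro i
    simp only [f]
    split_ifs with hi
    · exact hf₀ i
    · rw [map_zero, hzM i (not_lt.1 hi)]
  set m := minpoly (valueField c) pb.gen with hm
  have hint : IsIntegral (valueField c) pb.gen := Algebra.IsIntegral.isIntegral _
  have hmonic : m.Monic := minpoly.monic hint
  set W := (ringOps fun i => (MvPolynomial.C (Polynomial.C ⟨c i, .reg i, rfl⟩) :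
    MvPolynomial (Fin 3) (Polynomial (valueField c)))).system d (factorNumber d) (factorDegree d)
      (fun i => MvPolynomial.C (f i)) (MvPolynomial.X 0) (MvPolynomial.X 1) (MvPolynomial.X 2)
    with hW
  have hdvd : MvPolynomial.C m ∣ W := by
    rw [MvPolynomial.C_dvd_iff_map_hom_eq_zero
      (Polynomial.aeval pb.gen : Polynomial (valueField c) →ₐ[valueField c] L).toRingHom m
      fun r => (minpoly.dvd_iff).symm]
    have := (isHom_ringOps (fun i => (MvPolynomial.C (Polynomial.C ⟨c i, .reg i, rfl⟩) :
      MvPolynomial (Fin 3) (Polynomial (valueField c))))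
      (MvPolynomial.map (Polynomial.aeval pb.gen :
        Polynomial (valueField c) →ₐ[valueField c] L).toRingHom)).map_system d
      (factorNumber d) (factorDegree d) (fun i => MvPolynomial.C (f i)) (MvPolynomial.X 0)
      (MvPolynomial.X 1) (MvPolynomial.X 2)
    rw [hW, this]
    simpa [hf] using hvanish
  obtain ⟨Q, hQ⟩ := hdvd
  -- translation into symbolic polynomials
  have hexpr : ∀ a : valueField c, ∃ e : ArithExpr, e.eval c = a := fun a => a.2
  choose expr hexpr using hexpr
  let ι : Polynomial (valueField c) →+* MvPolynomial ℕ K :=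
    (Polynomial.aeval (MvPolynomial.X 3) : Polynomial K →ₐ[K] MvPolynomial ℕ K).toRingHom.comp
      (Polynomial.mapRingHom (valueField c).subtype)
  have hι : ∀ p, ι p = Polynomial.aeval (MvPolynomial.X 3)
      (p.map (valueField c).subtype) := fun _ => rfl
  let θ : MvPolynomial (Fin 3) (Polynomial (valueField c)) →+* MvPolynomial ℕ K :=
    MvPolynomial.eval₂Hom ι fun i => MvPolynomial.X (i : ℕ)
  have hθC : ∀ p, θ (MvPolynomial.C p) = ι p := fun p => MvPolynomial.eval₂Hom_C _ _ p
  have hιmem : ∀ p, ι p ∈ symbolicSubring c := by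
    intro p
    induction p using Polynomial.induction_on' with
    | add p q hp hq =>
      rw [map_add]
      exact add_mem hp hq
    | monomial n a =>
      rw [hι, Polynomial.map_monomial, Polynomial.aeval_monomial]
      exact mul_mem (C_mem_symbolicSubring c a) (pow_mem (X_mem_symbolicSubring c 3) n)
  have hθ : ∀ q, θ q ∈ symbolicSubring c := by
    intro q
    induction q using MvPolynomial.induction_on with
    | C a =>
      rw [hθC]
      exact hιmem a
    | add p q hp hq =>
      rw [map_add]
      exact add_mem hp hq
    | mul_X p i hp =>
      rw [map_mul]
      refine mul_mem hp ?_
      simp only [θ, MvPolynomial.eval₂Hom_X']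
      exact X_mem_symbolicSubring c i
  obtain ⟨Q', hQ'⟩ := hθ Q
  dsimp only at hQ'
  let coeffs : ℕ → Polynomial (valueField c) → List ArithExpr :=
    fun n p => (List.range n).map fun i => expr (p.coeff i)
  have hcoeffs : ∀ n p, ∑ i ∈ Finset.range (coeffs n p).length,
      Polynomial.C (((coeffs n p).getD i .zero).eval c) * Polynomial.X ^ i =
      (∑ i ∈ Finset.range n, Polynomial.C (p.coeff i) * Polynomial.X ^ i).map
        (valueField c).subtype := by
    intro n p
    rw [Polynomial.map_sum]
    have hlen : (coeffs n p).length = n := by simp [coeffs]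
    rw [hlen]
    refine Finset.sum_congr rfl fun i hi => ?_
    rw [List.getD_eq_getElem _ _ (by rw [hlen]; exact Finset.mem_range.1 hi)]
    simp [coeffs, hexpr]
  obtain ⟨a, l, hal⟩ : ∃ a l, coeffs m.natDegree m = a :: l := by
    refine List.exists_cons_of_length_pos ?_
    have hpos := minpoly.natDegree_pos hint
    simp only [coeffs, List.length_map, List.length_range]
    exact hpos
  refine ⟨(a, l, (List.range M).map fun i => coeffs ((f i).natDegree + 1) (f i), Q'), ?_⟩
  rw [SymPoly.eval_zeroTest, eval_solutionCert_poly, sub_eq_zero]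
  have hmeval : (SymPoly.monicOfCoeffs (a :: l)).eval c
      (MvPolynomial.X : ℕ → MvPolynomial ℕ K) = θ (MvPolynomial.C m) := by
    rw [← hal, SymPoly.eval_monicOfCoeffs, hcoeffs, hθC, hι]
    conv_rhs => rw [hmonic.as_sum]
    simp [coeffs]
  have hzeval : ∀ i, (((List.range M).map fun i => coeffs ((f i).natDegree + 1) (f i)).map
      SymPoly.ofCoeffs |>.getD i []).eval c (MvPolynomial.X : ℕ → MvPolynomial ℕ K) =
      θ (MvPolynomial.C (f i)) := by
    intro i
    rw [hθC, hι]
    by_cases hi : i < M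
    · rw [List.getD_eq_getElem _ _ (by simpa using hi)]
      simp only [List.getElem_map, List.getElem_range]
      rw [SymPoly.eval_ofCoeffs, hcoeffs, ← Polynomial.as_sum_range_C_mul_X_pow]
    · rw [List.getD_eq_default _ _ (by simpa using hi), SymPoly.eval_nil]
      simp [f, hi]
  dsimp only
  rw [hmeval, hQ', ← map_mul, ← hQ, hW]
  have := (isHom_ringOps (fun i => (MvPolynomial.C (Polynomial.C ⟨c i, .reg i, rfl⟩) :
      MvPolynomial (Fin 3) (Polynomial (valueField c)))) θ).map_system d
      (factorNumber d) (factorDegree d) (fun i => MvPolynomial.C (f i)) (MvPolynomial.X 0)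
      (MvPolynomial.X 1) (MvPolynomial.X 2)
  rw [this]
  simp only [hzeval]
  have hc : (fun i => θ (MvPolynomial.C (Polynomial.C ⟨c i, .reg i, rfl⟩))) =
      fun i => algebraMap K (MvPolynomial ℕ K) (c i) := by
    funext i
    rw [hθC, hι]
    simp
  rw [hc]
  simp [θ]

/-- One of the two kinds of certificates always exists. Either the values of the system generate
the unit ideal over the field of values, or they vanish in the residue field of a maximal ideal,
which is a finite extension of the field of values. -/
theorem exists_cert [CharZero K] (d : SparsePoly × SparsePoly) :
    (∃ C : SolutionCert, (SymPoly.zeroTest (C.poly d)).eval c = 1) ∨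
      ∃ C : NoSolutionCert, (SymPoly.zeroTest (C.poly d)).eval c = 1 := by
  by_cases h : Ideal.span (Set.range fun p : ℕ × ℕ × ℕ =>
      (ringOps fun i => (MvPolynomial.C ⟨c i, .reg i, rfl⟩ : MvPolynomial
        (Fin (unknownBound (factorNumber d) (factorDegree d))) (valueField c))).system d
        (factorNumber d) (factorDegree d)
        (fun i => if hi : i < unknownBound (factorNumber d) (factorDegree d) then
          MvPolynomial.X ⟨i, hi⟩ else 0) p.1 p.2.1 p.2.2) = ⊤
  · exact Or.inr (exists_noSolutionCert c d h)
  left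
  obtain ⟨m, hm, hle⟩ := Ideal.exists_le_maximal _ h
  let A := MvPolynomial (Fin (unknownBound (factorNumber d) (factorDegree d))) (valueField c)
  let _ : Field (A ⧸ m) := Ideal.Quotient.field m
  have : Module.Finite (valueField c) (A ⧸ m) :=
    finite_of_finite_type_of_isJacobsonRing (valueField c) (A ⧸ m)
  refine exists_solutionCert c d (L := A ⧸ m)
    (fun i => Ideal.Quotient.mk m (if hi : i < unknownBound (factorNumber d) (factorDegree d) then
      MvPolynomial.X ⟨i, hi⟩ else 0))
    (M := unknownBound (factorNumber d) (factorDegree d))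
    (fun i hi => by rw [dif_neg (not_lt.2 hi), map_zero]) fun a b e => ?_
  have hmem := hle (Ideal.subset_span ⟨(a, b, e), rfl⟩)
  have hsys := (isHom_ringOps (fun i => (MvPolynomial.C ⟨c i, .reg i, rfl⟩ : A))
    (Ideal.Quotient.mk m)).map_system d (factorNumber d) (factorDegree d)
    (fun i => if hi : i < unknownBound (factorNumber d) (factorDegree d) then
      MvPolynomial.X ⟨i, hi⟩ else 0) a b e
  rw [Ideal.Quotient.eq_zero_iff_mem.2 hmem] at hsys
  simp only [map_natCast] at hsys
  exact hsys.symm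

end Completeness

/-! ### Computability of the tests -/

namespace ArithExpr

theorem primrec_reg : Primrec ArithExpr.reg :=
  Primrec.encode_iff.1 (Primrec.nat_add.comp (Primrec.nat_mul.comp (Primrec.const 5) Primrec.id)
    (Primrec.const 2))

theorem primrec_pair (k : ℕ) :
    Primrec₂ fun a b : ArithExpr => 5 * Nat.pair (Encodable.encode a) (Encodable.encode b) + k :=
  Primrec.nat_add.comp (Primrec.nat_mul.comp (Primrec.const 5)
    (Primrec₂.natPair.comp (Primrec.encode.comp Primrec.fst) (Primrec.encode.comp Primrec.snd)))
    (Primrec.const k)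

theorem primrec_add : Primrec₂ ArithExpr.add := Primrec₂.encode_iff.1 (primrec_pair 3)

theorem primrec_sub : Primrec₂ ArithExpr.sub := Primrec₂.encode_iff.1 (primrec_pair 4)

theorem primrec_mul : Primrec₂ ArithExpr.mul := Primrec₂.encode_iff.1 (primrec_pair 5)

theorem primrec_div : Primrec₂ ArithExpr.div := Primrec₂.encode_iff.1 (primrec_pair 6)

end ArithExpr

/-- The operations are primitive recursive. -/
structure Ops.IsPrimrec {R : Type*} [Primcodable R] (o : Ops R) : Prop where
  add : Primrec₂ o.add
  mul : Primrec₂ o.mul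
  reg : Primrec o.reg

namespace Ops.IsPrimrec

variable {R : Type*} [Primcodable R] {o : Ops R} {α : Type*} [Primcodable α]

theorem sub (h : o.IsPrimrec) : Primrec₂ o.sub :=
  h.add.comp Primrec.fst (h.mul.comp (Primrec.const o.neg) Primrec.snd)

theorem natCast (h : o.IsPrimrec) : Primrec o.natCast := by
  have hstep : Primrec₂ fun (_ : ℕ) (b : ℕ × R) => o.add b.2 o.one :=
    h.add.comp (Primrec.snd.comp Primrec.snd) (Primrec.const o.one)
  exact Primrec.nat_rec' Primrec.id (Primrec.const o.zero) hstep

theorem pow (h : o.IsPrimrec) : Primrec₂ o.pow := by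
  have hstep : Primrec₂ fun (a : R × ℕ) (b : ℕ × R) => o.mul b.2 a.1 :=
    h.mul.comp (Primrec.snd.comp Primrec.snd) (Primrec.fst.comp Primrec.fst)
  exact Primrec.nat_rec' Primrec.snd (Primrec.const o.one) hstep

theorem horner (h : o.IsPrimrec) {n : α → ℕ} {coef : α → ℕ → R} {x : α → R} (hn : Primrec n)
    (hcoef : Primrec₂ coef) (hx : Primrec x) :
    Primrec fun a => o.horner (n a) (coef a) (x a) := by
  have hstep : Primrec₂ fun (a : α) (b : ℕ × R) => o.add (o.mul b.2 (x a)) (coef a b.1) :=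
    h.add.comp (h.mul.comp (Primrec.snd.comp Primrec.snd) (hx.comp Primrec.fst))
      (hcoef.comp Primrec.fst (Primrec.fst.comp Primrec.snd))
  exact Primrec.nat_rec' hn (Primrec.const o.zero) hstep

theorem unknownPoly (h : o.IsPrimrec) {B : α → ℕ} {z : α → ℕ → R} {q : α → ℕ} {x y : α → R}
    (hB : Primrec B) (hz : Primrec₂ z) (hq : Primrec q) (hx : Primrec x) (hy : Primrec y) :
    Primrec fun a => o.unknownPoly (B a) (z a) (q a) (x a) (y a) := by
  refine h.horner hB ?_ hx
  refine h.horner (α := α × ℕ) (hB.comp Primrec.fst) ?_ (hy.comp Primrec.fst)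
  exact hz.comp (Primrec.fst.comp Primrec.fst) (Primrec₂.natPair.comp
    (hq.comp (Primrec.fst.comp Primrec.fst))
    (Primrec₂.natPair.comp (Primrec.snd.comp Primrec.fst) Primrec.snd))

theorem sparse (h : o.IsPrimrec) {p : α → SparsePoly} {x y : α → R} (hp : Primrec p)
    (hx : Primrec x) (hy : Primrec y) : Primrec fun a => o.sparse (p a) (x a) (y a) := by
  have ht : Primrec fun b : α × ((ℕ × ℕ × ℕ) × R) => b.2.1 := Primrec.fst.comp Primrec.snd
  have hstep : Primrec₂ fun (a : α) (b : (ℕ × ℕ × ℕ) × R) =>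
      o.add (o.mul (o.mul (o.reg b.1.2.2) (o.pow (x a) b.1.1)) (o.pow (y a) b.1.2.1)) b.2 :=
    h.add.comp (h.mul.comp (h.mul.comp
    (h.reg.comp (Primrec.snd.comp (Primrec.snd.comp ht)))
    (h.pow.comp (hx.comp Primrec.fst) (Primrec.fst.comp ht)))
    (h.pow.comp (hy.comp Primrec.fst) (Primrec.fst.comp (Primrec.snd.comp ht))))
    (Primrec.snd.comp Primrec.snd)
  exact Primrec.list_foldr hp (Primrec.const o.zero) hstep

theorem primrec_five_mul_add (i : ℕ) : Primrec fun k : ℕ => 5 * k + i :=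
  Primrec.nat_add.comp (Primrec.nat_mul.comp (Primrec.const 5) Primrec.id) (Primrec.const i)

theorem orbit (h : o.IsPrimrec) {B : α → ℕ} {z : α → ℕ → R} {x y : α → R} {k : α → ℕ}
    (hB : Primrec B) (hz : Primrec₂ z) (hx : Primrec x) (hy : Primrec y) (hk : Primrec k) :
    Primrec fun a => o.orbit (B a) (z a) (x a) (y a) (k a) := by
  have ha : Primrec fun b : α × (ℕ × (R × R)) => b.1 := Primrec.fst
  have hi : Primrec fun b : α × (ℕ × (R × R)) => b.2.1 := Primrec.fst.comp Primrec.snd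
  have hp : Primrec fun b : α × (ℕ × (R × R)) => b.2.2 := Primrec.snd.comp Primrec.snd
  have hz' : Primrec₂ fun (b : α × (ℕ × (R × R))) (i : ℕ) => z b.1 i :=
    hz.comp (ha.comp Primrec.fst) Primrec.snd
  have hpoly : ∀ i, Primrec fun b : α × (ℕ × (R × R)) =>
      o.unknownPoly (B b.1) (z b.1) (5 * b.2.1 + i) b.2.2.1 b.2.2.2 := fun i =>
    h.unknownPoly (hB.comp ha) hz' ((primrec_five_mul_add i).comp hi) (Primrec.fst.comp hp)
      (Primrec.snd.comp hp)
  have he : Primrec fun b : α × (ℕ × (R × R)) => z b.1 (Nat.pair (5 * b.2.1 + 4) 0) :=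
    hz.comp ha (Primrec₂.natPair.comp ((primrec_five_mul_add 4).comp hi) (Primrec.const 0))
  have hstep : Primrec₂ fun (a : α) (b : ℕ × (R × R)) =>
      (o.unknownPoly (B a) (z a) (5 * b.1) b.2.1 b.2.2,
        o.mul (o.add (o.mul (z a (Nat.pair (5 * b.1 + 4) 0))
          (o.unknownPoly (B a) (z a) (5 * b.1) b.2.1 b.2.2))
          (o.sub o.one (z a (Nat.pair (5 * b.1 + 4) 0))))
          (o.unknownPoly (B a) (z a) (5 * b.1 + 1) b.2.1 b.2.2)) :=
    Primrec.pair (hpoly 0) (h.mul.comp (h.add.comp (h.mul.comp he (hpoly 0))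
      (h.sub.comp (Primrec.const o.one) he)) (hpoly 1))
  exact Primrec.nat_rec' hk (Primrec.pair hx hy) hstep

theorem inverseErrors (h : o.IsPrimrec) {B : α → ℕ} {z : α → ℕ → R} {x y u : α → R} {k : α → ℕ}
    (hB : Primrec B) (hz : Primrec₂ z) (hx : Primrec x) (hy : Primrec y) (hu : Primrec u)
    (hk : Primrec k) :
    Primrec fun a => o.inverseErrors (B a) (z a) (x a) (y a) (u a) (k a) := by
  have ha : Primrec fun b : α × (ℕ × R) => b.1 := Primrec.fst
  have hi : Primrec fun b : α × (ℕ × R) => b.2.1 := Primrec.fst.comp Primrec.snd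
  have hr : Primrec fun b : α × (ℕ × R) => b.2.2 := Primrec.snd.comp Primrec.snd
  have hz' : Primrec₂ fun (b : α × (ℕ × R)) (i : ℕ) => z b.1 i :=
    hz.comp (ha.comp Primrec.fst) Primrec.snd
  have hpoly : ∀ i, Primrec fun b : α × (ℕ × R) =>
      o.unknownPoly (B b.1) (z b.1) (5 * b.2.1 + i) (x b.1) (y b.1) := fun i =>
    h.unknownPoly (hB.comp ha) hz' ((primrec_five_mul_add i).comp hi) (hx.comp ha) (hy.comp ha)
  have hinv : ∀ i, Primrec fun b : α × (ℕ × R) =>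
      o.inverseValue (B b.1) (z b.1) (x b.1) (y b.1) i b.2.1 := fun i =>
    h.unknownPoly (hB.comp ha) hz' ((primrec_five_mul_add i).comp hi) (hpoly 0) (hpoly 1)
  have hstep : Primrec₂ fun (a : α) (b : ℕ × R) =>
      o.add (o.mul (o.add (o.mul b.2 (u a))
        (o.sub (o.inverseValue (B a) (z a) (x a) (y a) 2 b.1) (x a))) (u a))
        (o.sub (o.inverseValue (B a) (z a) (x a) (y a) 3 b.1) (y a)) :=
    h.add.comp (h.mul.comp (h.add.comp (h.mul.comp hr (hu.comp ha))
      (h.sub.comp (hinv 2) (hx.comp ha))) (hu.comp ha)) (h.sub.comp (hinv 3) (hy.comp ha))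
  exact Primrec.nat_rec' hk (Primrec.const o.zero) hstep

theorem system (h : o.IsPrimrec) {d : α → SparsePoly × SparsePoly} {N B : α → ℕ}
    {z : α → ℕ → R} {x y u : α → R} (hd : Primrec d) (hN : Primrec N) (hB : Primrec B)
    (hz : Primrec₂ z) (hx : Primrec x) (hy : Primrec y) (hu : Primrec u) :
    Primrec fun a => o.system (d a) (N a) (B a) (z a) (x a) (y a) (u a) := by
  have horb := h.orbit hB hz hx hy hN
  exact h.add.comp (h.mul.comp (h.add.comp (h.mul.comp (h.inverseErrors hB hz hx hy hu hN) hu)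
    (h.sub.comp (h.sparse (Primrec.fst.comp hd) hx hy) (Primrec.fst.comp horb))) hu)
    (h.sub.comp (h.sparse (Primrec.snd.comp hd) hx hy) (Primrec.snd.comp horb))

end Ops.IsPrimrec

theorem primrec_nat_pow : Primrec₂ fun a b : ℕ => a ^ b :=
  Primrec₂.unpaired'.1 Nat.Primrec.pow

theorem primrec_degreeGrowth : Primrec degreeGrowth := by
  have h2 : Primrec fun D : ℕ => 2 * D + 2 :=
    Primrec.nat_add.comp (Primrec.nat_mul.comp (Primrec.const 2) Primrec.id) (Primrec.const 2)
  exact Primrec.nat_mul.comp Primrec.succ (Primrec.nat_mul.comp (Primrec.const 2)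
    (primrec_nat_pow.comp (Primrec.nat_add.comp (primrec_nat_pow.comp h2 (Primrec.const 3))
      (Primrec.const 2)) (Primrec.const 2)))

theorem primrec_two_mul_add_one : Primrec fun D : ℕ => 2 * D + 1 :=
  Primrec.succ.comp (Primrec.nat_mul.comp (Primrec.const 2) Primrec.id)

theorem primrec_factorBound : Primrec factorBound :=
  Primrec.succ.comp (Primrec.nat_iterate primrec_two_mul_add_one Primrec.id
    (primrec_degreeGrowth.comp Primrec.snd))

theorem primrec_sparseDegree : Primrec sparseDegree := by
  have hsum : Primrec fun p : SparsePoly => (p.map fun t => t.1 + t.2.1).sum := by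
    have h : Primrec fun p : SparsePoly => p.foldr (fun t r => t.1 + t.2.1 + r) 0 := by
      have ht : Primrec fun b : SparsePoly × ((ℕ × ℕ × ℕ) × ℕ) => b.2.1 :=
        Primrec.fst.comp Primrec.snd
      have hstep : Primrec₂ fun (_ : SparsePoly) (b : (ℕ × ℕ × ℕ) × ℕ) =>
          b.1.1 + b.1.2.1 + b.2 :=
        Primrec.nat_add.comp (Primrec.nat_add.comp (Primrec.fst.comp ht)
          (Primrec.fst.comp (Primrec.snd.comp ht))) (Primrec.snd.comp Primrec.snd)
      exact Primrec.list_foldr Primrec.id (Primrec.const 0) hstep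
    refine h.of_eq fun p => ?_
    induction p with
    | nil => rfl
    | cons t p ih => simp [ih]
  exact Primrec.nat_add.comp (hsum.comp Primrec.fst) (hsum.comp Primrec.snd)

theorem primrec_factorNumber : Primrec factorNumber :=
  primrec_two_mul_add_one.comp primrec_sparseDegree

theorem primrec_factorDegree : Primrec factorDegree :=
  Primrec.succ.comp (primrec_factorBound.comp primrec_sparseDegree)

theorem primrec_unknownBound : Primrec₂ unknownBound :=
  Primrec₂.natPair.comp (Primrec.nat_mul.comp (Primrec.const 5) Primrec.fst)
    (Primrec₂.natPair.comp Primrec.snd Primrec.snd)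

theorem primrecRel_perm : PrimrecRel fun l l' : List ℕ => l.Perm l' := by
  have hcount : Primrec₂ fun (l : List ℕ) (i : ℕ) => l.count i := by
    have hf : Primrec₂ fun (l : List ℕ) (i : ℕ) => l.filter fun j => j = i :=
      PrimrecRel.listFilter (R := fun j i : ℕ => j = i) Primrec.eq
    refine (Primrec.list_length.comp hf).of_eq fun p => ?_
    dsimp only
    rw [List.count_eq_length_filter]
    rfl
  have hrel : PrimrecRel fun (i : ℕ) (p : List ℕ × List ℕ) => p.1.count i = p.2.count i :=
    Primrec.eq.comp (hcount.comp (Primrec.fst.comp Primrec.snd) Primrec.fst)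
      (hcount.comp (Primrec.snd.comp Primrec.snd) Primrec.fst)
  have hall := hrel.forall_mem_list.comp
    (Primrec.list_append.comp (Primrec.fst (α := List ℕ) (β := List ℕ)) Primrec.snd) Primrec.id
  refine PrimrecPred.of_eq hall fun p => ?_
  simp only [id_eq]
  rw [List.perm_iff_count]
  refine ⟨fun h i => ?_, fun h i _ => h i⟩
  by_cases hi : i ∈ p.1 ++ p.2
  · exact h i hi
  · rw [List.mem_append, not_or] at hi
    rw [List.count_eq_zero_of_not_mem hi.1, List.count_eq_zero_of_not_mem hi.2]

namespace SymPoly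

theorem primrec_const : Primrec const :=
  Primrec.list_cons.comp (Primrec.pair (Primrec.const []) Primrec.id) (Primrec.const [])

theorem primrec_var : Primrec var :=
  Primrec.list_cons.comp (Primrec.pair (Primrec.list_cons.comp Primrec.id (Primrec.const []))
    (Primrec.const ArithExpr.one)) (Primrec.const [])

theorem isPrimrec_ops : ops.IsPrimrec where
  add := Primrec.list_append
  mul := by
    refine Primrec.list_flatMap Primrec.fst ?_
    refine Primrec.list_map (Primrec.snd.comp Primrec.fst) ?_
    have ht : Primrec fun b : ((SymPoly × SymPoly) × (List ℕ × ArithExpr)) ×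
        (List ℕ × ArithExpr) => b.1.2 := Primrec.snd.comp Primrec.fst
    exact Primrec.pair (Primrec.list_append.comp (Primrec.fst.comp ht)
      (Primrec.fst.comp Primrec.snd)) (ArithExpr.primrec_mul.comp (Primrec.snd.comp ht)
      (Primrec.snd.comp Primrec.snd))
  reg := primrec_const.comp ArithExpr.primrec_reg

theorem primrec_coeffExpr : Primrec₂ coeffExpr := by
  have ht : Primrec fun b : (SymPoly × List ℕ) × ((List ℕ × ArithExpr) × ArithExpr) => b.2.1 :=
    Primrec.fst.comp Primrec.snd
  have hr : Primrec fun b : (SymPoly × List ℕ) × ((List ℕ × ArithExpr) × ArithExpr) => b.2.2 :=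
    Primrec.snd.comp Primrec.snd
  have hstep : Primrec₂ fun (a : SymPoly × List ℕ) (b : (List ℕ × ArithExpr) × ArithExpr) =>
      if b.1.1.Perm a.2 then ArithExpr.add b.1.2 b.2 else b.2 :=
    Primrec.ite (primrecRel_perm.comp (Primrec.fst.comp ht) (Primrec.snd.comp Primrec.fst))
      (ArithExpr.primrec_add.comp (Primrec.snd.comp ht) hr) hr
  exact Primrec.list_foldr Primrec.fst (Primrec.const ArithExpr.zero) hstep

theorem primrec_isZeroExpr : Primrec isZeroExpr :=
  ArithExpr.primrec_sub.comp (Primrec.const ArithExpr.one)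
    (ArithExpr.primrec_div.comp Primrec.id Primrec.id)

theorem primrec_zeroTest : Primrec zeroTest := by
  have hstep : Primrec₂ fun (P : SymPoly) (b : (List ℕ × ArithExpr) × ArithExpr) =>
      ArithExpr.mul (isZeroExpr (coeffExpr P b.1.1)) b.2 :=
    ArithExpr.primrec_mul.comp (primrec_isZeroExpr.comp (primrec_coeffExpr.comp Primrec.fst
      (Primrec.fst.comp (Primrec.fst.comp Primrec.snd)))) (Primrec.snd.comp Primrec.snd)
  exact Primrec.list_foldr Primrec.id (Primrec.const ArithExpr.one) hstep

theorem primrec_foldr_coeffs (base : SymPoly) : Primrec fun l : List ArithExpr =>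
    l.foldr (fun a r => ops.add (const a) (ops.mul (var 3) r)) base := by
  have hstep : Primrec₂ fun (_ : List ArithExpr) (b : ArithExpr × SymPoly) =>
      ops.add (const b.1) (ops.mul (var 3) b.2) :=
    isPrimrec_ops.add.comp (primrec_const.comp (Primrec.fst.comp Primrec.snd))
      (isPrimrec_ops.mul.comp (Primrec.const (var 3)) (Primrec.snd.comp Primrec.snd))
  exact Primrec.list_foldr Primrec.id (Primrec.const base) hstep

theorem primrec_ofCoeffs : Primrec ofCoeffs := primrec_foldr_coeffs _

theorem primrec_monicOfCoeffs : Primrec monicOfCoeffs := primrec_foldr_coeffs _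

end SymPoly

theorem primrec_symSystem {α : Type*} [Primcodable α] {d : α → SparsePoly × SparsePoly}
    {z : α → List SymPoly} {x y u : α → SymPoly} (hd : Primrec d) (hz : Primrec z)
    (hx : Primrec x) (hy : Primrec y) (hu : Primrec u) :
    Primrec fun a => symSystem (d a) (z a) (x a) (y a) (u a) :=
  SymPoly.isPrimrec_ops.system hd (primrec_factorNumber.comp hd) (primrec_factorDegree.comp hd)
    ((Primrec.list_getD ([] : SymPoly)).comp (hz.comp Primrec.fst) Primrec.snd) hx hy hu

theorem primrec_solutionCert_poly : Primrec₂ fun d C => SolutionCert.poly d C := by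
  have hC : Primrec fun b : (SparsePoly × SparsePoly) × SolutionCert => b.2 := Primrec.snd
  exact SymPoly.isPrimrec_ops.sub.comp
    (primrec_symSystem Primrec.fst
      (Primrec.list_map (Primrec.fst.comp (Primrec.snd.comp (Primrec.snd.comp hC)))
        (SymPoly.primrec_ofCoeffs.comp Primrec.snd))
      (Primrec.const _) (Primrec.const _) (Primrec.const _))
    (SymPoly.isPrimrec_ops.mul.comp
      (SymPoly.primrec_monicOfCoeffs.comp (Primrec.list_cons.comp (Primrec.fst.comp hC)
        (Primrec.fst.comp (Primrec.snd.comp hC))))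
      (Primrec.snd.comp (Primrec.snd.comp (Primrec.snd.comp hC))))

theorem primrec_noSolutionCert_poly : Primrec₂ fun d C => NoSolutionCert.poly d C := by
  have hd : Primrec fun b : ((SparsePoly × SparsePoly) × NoSolutionCert) ×
      (((ℕ × ℕ × ℕ) × SymPoly) × SymPoly) => b.1.1 := Primrec.fst.comp Primrec.fst
  have ht : Primrec fun b : ((SparsePoly × SparsePoly) × NoSolutionCert) ×
      (((ℕ × ℕ × ℕ) × SymPoly) × SymPoly) => b.2.1 := Primrec.fst.comp Primrec.snd
  have hp := Primrec.fst.comp ht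
  have hcast := SymPoly.isPrimrec_ops.natCast
  have hstep : Primrec₂ fun (a : (SparsePoly × SparsePoly) × NoSolutionCert)
      (b : ((ℕ × ℕ × ℕ) × SymPoly) × SymPoly) =>
      SymPoly.ops.add (SymPoly.ops.mul b.1.2 (symSystem a.1
        ((List.range (unknownBound (factorNumber a.1) (factorDegree a.1))).map SymPoly.var)
        (SymPoly.ops.natCast b.1.1.1) (SymPoly.ops.natCast b.1.1.2.1)
        (SymPoly.ops.natCast b.1.1.2.2))) b.2 :=
    SymPoly.isPrimrec_ops.add.comp (SymPoly.isPrimrec_ops.mul.comp (Primrec.snd.comp ht)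
      (primrec_symSystem hd
        (Primrec.list_map (Primrec.list_range.comp (primrec_unknownBound.comp
          (primrec_factorNumber.comp hd) (primrec_factorDegree.comp hd)))
          (SymPoly.primrec_var.comp Primrec.snd))
        (hcast.comp (Primrec.fst.comp hp))
        (hcast.comp (Primrec.fst.comp (Primrec.snd.comp hp)))
        (hcast.comp (Primrec.snd.comp (Primrec.snd.comp hp)))))
      (Primrec.snd.comp Primrec.snd)
  exact Primrec.list_foldr Primrec.snd (Primrec.const SymPoly.ops.neg) hstep

/-! ### The algorithm -/

/-- The certificate with the number `n`, if there is one. -/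
def decodeCert (n : ℕ) : Option (SolutionCert ⊕ NoSolutionCert) :=
  @Encodable.decode _ Primcodable.toEncodable n

theorem primrec_decodeCert : Primrec decodeCert := Primrec.decode

theorem exists_decodeCert (C : SolutionCert ⊕ NoSolutionCert) : ∃ n, decodeCert n = some C :=
  ⟨@Encodable.encode _ Primcodable.toEncodable C, @Encodable.encodek _ Primcodable.toEncodable C⟩

/-- The polynomial that vanishes if and only if the certificate is valid for `d`. -/
def certPoly (d : SparsePoly × SparsePoly) : SolutionCert ⊕ NoSolutionCert → SymPoly
  | .inl C => SolutionCert.poly d C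
  | .inr C => NoSolutionCert.poly d C

/-- An expression that has the value `1` if and only if `n` is the number of a valid
certificate for `d`. -/
def certTest (d : SparsePoly × SparsePoly) (n : ℕ) : ArithExpr :=
  ((decodeCert n).map fun C => (certPoly d C).zeroTest).getD .zero

/-- The answer that is given by the certificate with the number `n`. -/
def certAnswer (n : ℕ) : Bool := ((decodeCert n).map Sum.isLeft).getD false

theorem primrec_certPoly : Primrec₂ certPoly := by
  have hl : Primrec₂ fun (a : (SparsePoly × SparsePoly) × (SolutionCert ⊕ NoSolutionCert))
      (C : SolutionCert) => SolutionCert.poly a.1 C :=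
    primrec_solutionCert_poly.comp (Primrec.fst.comp Primrec.fst) Primrec.snd
  have hr : Primrec₂ fun (a : (SparsePoly × SparsePoly) × (SolutionCert ⊕ NoSolutionCert))
      (C : NoSolutionCert) => NoSolutionCert.poly a.1 C :=
    primrec_noSolutionCert_poly.comp (Primrec.fst.comp Primrec.fst) Primrec.snd
  have h : Primrec fun a : (SparsePoly × SparsePoly) × (SolutionCert ⊕ NoSolutionCert) =>
      (Sum.casesOn a.2 (fun C => SolutionCert.poly a.1 C) fun C => NoSolutionCert.poly a.1 C :
        SymPoly) := Primrec.sumCasesOn Primrec.snd hl hr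
  have heq : ∀ d C, (Sum.casesOn C (fun C => SolutionCert.poly d C)
      fun C => NoSolutionCert.poly d C : SymPoly) = certPoly d C := by
    rintro d (C | C) <;> rfl
  exact h.of_eq fun a => heq a.1 a.2

theorem primrec_certTest : Primrec₂ certTest := by
  have hmap : Primrec₂ fun (a : (SparsePoly × SparsePoly) × ℕ)
      (C : SolutionCert ⊕ NoSolutionCert) => (certPoly a.1 C).zeroTest :=
    SymPoly.primrec_zeroTest.comp
      (primrec_certPoly.comp (Primrec.fst.comp Primrec.fst) Primrec.snd)
  exact Primrec.option_getD.comp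
    (Primrec.option_map (primrec_decodeCert.comp Primrec.snd) hmap) (Primrec.const ArithExpr.zero)

theorem primrec_certAnswer : Primrec certAnswer := by
  have hleft : Primrec (Sum.isLeft : SolutionCert ⊕ NoSolutionCert → Bool) := by
    refine (Primrec.sumCasesOn Primrec.id (Primrec.const true).to₂
      (Primrec.const false).to₂).of_eq ?_
    rintro (C | C) <;> rfl
  exact Primrec.option_getD.comp (Primrec.option_map primrec_decodeCert (hleft.comp₂ .right))
    (Primrec.const false)

/-- The search for a valid certificate: the `n`-th step tests the certificate with the number `n`,
and the first successful test determines the answer. -/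
def certSearch : FieldAlgorithm (SparsePoly × SparsePoly) where
  next p :=
    if p.2.idxOf true < p.2.length then Sum.inr (certAnswer (p.2.idxOf true))
    else Sum.inl (certTest p.1 (p.2.idxOf true), .one)
  computable_next := by
    have hidx : Primrec fun p : (SparsePoly × SparsePoly) × List Bool => p.2.idxOf true :=
      Primrec.list_idxOf.comp (Primrec.const true) Primrec.snd
    refine (Primrec.ite (Primrec.nat_lt.comp hidx (Primrec.list_length.comp Primrec.snd))
      (Primrec.sumInr.comp (primrec_certAnswer.comp hidx))
      (Primrec.sumInl.comp (Primrec.pair (primrec_certTest.comp Primrec.fst hidx)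
        (Primrec.const ArithExpr.one)))).to_comp

section Run

variable {K : Type*} [Field K] {d : SparsePoly × SparsePoly} {c : ℕ → K}

theorem certSearch_next_replicate (d : SparsePoly × SparsePoly) (n : ℕ) :
    certSearch.next (d, List.replicate n false) = Sum.inl (certTest d n, .one) := by
  simp [certSearch]

theorem certSearch_next_replicate_append (d : SparsePoly × SparsePoly) (n : ℕ) :
    certSearch.next (d, List.replicate n false ++ [true]) = Sum.inr (certAnswer n) := by
  have h : (List.replicate n false ++ [true]).idxOf true = n := by
    rw [List.idxOf_append_of_notMem (by simp)]
    simp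
  simp [certSearch, h]

/-- The search stops with the answer of the first valid certificate, and with no other answer. -/
theorem certSearch_outputs_iff {n : ℕ} (hn : (certTest d n).eval c = 1)
    (hmin : ∀ k < n, (certTest d k).eval c ≠ 1) (b : Bool) :
    certSearch.Outputs d c b ↔ certAnswer n = b := by
  have hbefore : ∀ k ≤ n, certSearch.history d c k = List.replicate k false := by
    intro k
    induction k with
    | zero => intro _; rfl
    | succ k ih =>
      intro hk
      rw [FieldAlgorithm.history, ih (by omega), certSearch_next_replicate]
      simp [hmin k (by omega), ArithExpr.eval, List.replicate_succ']
  have hafter : ∀ k, certSearch.history d c (n + 1 + k) = List.replicate n false ++ [true] := by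
    intro k
    induction k with
    | zero =>
      rw [Nat.add_zero, FieldAlgorithm.history, hbefore n le_rfl, certSearch_next_replicate]
      simp [hn, ArithExpr.eval]
    | succ k ih =>
      rw [← Nat.add_assoc, FieldAlgorithm.history, ih, certSearch_next_replicate_append]
  constructor
  · rintro ⟨k, hk⟩
    by_cases hkn : k ≤ n
    · rw [hbefore k hkn, certSearch_next_replicate] at hk
      simp at hk
    · obtain ⟨j, rfl⟩ := Nat.exists_eq_add_of_lt (not_le.1 hkn)
      rw [show n + j + 1 = n + 1 + j by omega, hafter, certSearch_next_replicate_append] at hk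
      exact Sum.inr.inj hk
  · rintro rfl
    exact ⟨n + 1, by rw [← certSearch_next_replicate_append d n, ← hafter 0]⟩

/-- A valid certificate gives the right answer. -/
theorem certAnswer_iff [IsAlgClosed K] [CharZero K] {φ : PlaneEnd K} (hd : Presents d c φ)
    {n : ℕ} (hn : (certTest d n).eval c = 1) :
    certAnswer n = true ↔ IsProductOfSimpleAffineContractions φ := by
  unfold certTest at hn
  unfold certAnswer
  cases hC : decodeCert n with
  | none => simp [hC, ArithExpr.eval] at hn
  | some C =>
    rw [hC, Option.map_some, Option.getD_some] at hn
    rw [Option.map_some, Option.getD_some]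
    cases C with
    | inl C =>
      obtain ⟨z, hz⟩ := SolutionCert.exists_isSolution hn
      exact iff_of_true rfl (hz.isProduct hd)
    | inr C =>
      refine iff_of_false Bool.false_ne_true fun hprod => ?_
      obtain ⟨z, hz, hsol⟩ := (hprod.boundedProduct hd.mapDegree_le).exists_isSolution hd
      exact NoSolutionCert.false hn hz hsol

theorem exists_certTest [CharZero K] (d : SparsePoly × SparsePoly) (c : ℕ → K) :
    ∃ n, (certTest d n).eval c = 1 := by
  obtain ⟨C, hC⟩ : ∃ C, (certPoly d C).zeroTest.eval c = 1 := by
    rcases exists_cert c d with ⟨C, hC⟩ | ⟨C, hC⟩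
    · exact ⟨.inl C, hC⟩
    · exact ⟨.inr C, hC⟩
  obtain ⟨n, hn⟩ := exists_decodeCert C
  exact ⟨n, by rw [certTest, hn, Option.map_some, Option.getD_some, hC]⟩

end Run

theorem theorem1p1 (K : Type*) [Field K] [IsAlgClosed K] [CharZero K] :
    ∃ A : FieldAlgorithm (SparsePoly × SparsePoly),
      ∀ φ : PlaneEnd K, IsBirationalMorphism φ →
        ∀ (d : SparsePoly × SparsePoly) (c : ℕ → K), Presents d c φ →
          (A.Outputs d c true ↔ IsProductOfSimpleAffineContractions φ) ∧
          (A.Outputs d c false ↔ ¬ IsProductOfSimpleAffineContractions φ) := by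
  classical
  refine ⟨certSearch, fun φ _ d c hd => ?_⟩
  have hex := exists_certTest d c
  have h := certSearch_outputs_iff (Nat.find_spec hex) fun k hk => Nat.find_min hex hk
  rw [h, h, ← certAnswer_iff hd (Nat.find_spec hex), Bool.not_eq_true]
  exact ⟨Iff.rfl, Iff.rfl⟩
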